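/- Let $\mathfrak r^i=\mathbb R[[x_i,\dots,x_3]]$ for $i=1,2,3$. Let $\mathfrak t$ be the space of feed-forward formal vector fields $V=\sum_{i=1}^3V_i\,\partial/\partial x_i$ with $V_i\in\mathfrak r^i$, let $\mathfrak t_1\subset\mathfrak t$ be the set of those without constant and linear terms, and let $\mathfrak r_1$ be the set of triples $r=(r^1,r^2,r^3)$ with $r^i\in\mathfrak r^i$ and $r^i(0)=0$. For such $r$ and $X\in\mathfrak t_1$ let $\rho(r,X)Y=r\star Y+[X,Y]$, where $r\star Y=\sum_i r^iY_i\,\partial/\partial x_i$ and $[X,Y]_i=\sum_j\bigl(X_j\,\partial Y_i/\partial x_j-Y_j\,\partial X_i/\partial x_j\bigr)$, and let $\exp\rho(r,X)=\sum_{k\ge 0}\rho(r,X)^k/k!$, which is a well-defined operator on $\mathfrak t$ because $\rho(r,X)$ raises the degree. Thus $\exp\rho(0,X)$ is a formal near-identity feed-forward change of coordinates, and $\exp\rho(r,0)$ multiplies the $i$-th component by $e^{r^i}$, i.e. rescales time separately in each component. Consider the feed-forward system $$\dot x_1=x_2+F_1(x_1,x_2,x_3),\qquad \dot x_2=x_3+F_2(x_2,x_3),\qquad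 \dot x_3=F_3(x_3),$$ where $F_i\in\mathfrak r^i$ has no constant and no linear terms, and let $V\in\mathfrak t$ be its vector field. Let $a_2,b_2,c_2$ be the coefficients of $x_1^2$ in $F_1$, of $x_2^2$ in $F_2$ and of $x_3^2$ in $F_3$, and assume that $a_2,b_2,c_2$ are all nonzero. For $a,b,c\in\mathbb R$ let $W_{a,b,c}$ be the vector field of $$\dot x_1=x_2+a\,x_1^2,\qquad \dot x_2=x_3+b\,x_2^2,\qquad \dot x_3=c\,x_3^2.$$ (i) There are $X\in\mathfrak t_1$ and $r\in\mathfrak r_1$ such that $$\exp\rho(r,0)\,\exp\rho(0,X)\,V=W_{a_2,b_2,c_2}.$$ Here $\exp\rho(r,0)\exp\rho(0,X)$ is a bijection of $\mathfrak t$, and $\exp\rho(0,X)$ is the change of coordinates by an invertible formal feed-forward map: there are mutually inverse formal maps $\varphi,\psi$ with $\varphi_i,\psi_i\in\mathfrak r^i$ and $\varphi_i-x_i$, $\psi_i-x_i$ of order at least $2$, such that for every $U\in\mathfrak t$ the field $U'=\exp\rho(0,X)U$ satisfies $U'_i(\varphi(x))=\sum_jU_j(x)\,\partial\varphi_i/\partial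 x_j(x)$ for $i=1,2,3$. (ii) The normal form is unique: if $V$ can be brought to $W_{a,b,c}$ by finitely many transformations $\exp\rho(r,X)$ with $r\in\mathfrak r_1$ and $X\in\mathfrak t_1$, then $a=a_2$, $b=b_2$, $c=c_2$. -/

import Mathlib

noncomputable section

namespace FeedForward

/-- Formal power series in `x₁, …, xₙ` (indexed by `Fin n`, so `x₁` has index `0`). -/
abbrev Series (n : ℕ) : Type := MvPowerSeries (Fin n) ℝ

/-- `ℝ[[xᵢ, …, xₙ]]`: only variables with index at least `i` occur. -/
def ringFrom {n : ℕ} (i : Fin n) : Set (Series n) :=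
  {f | ∀ d : Fin n →₀ ℕ, MvPowerSeries.coeff d f ≠ 0 → ∀ j, j < i → d j = 0}

/-- Feed-forward (triangular) formal vector fields `∑ᵢ Vᵢ ∂/∂xᵢ` with
`Vᵢ ∈ ℝ[[xᵢ, …, xₙ]]`. -/
def fields (n : ℕ) : Set (Fin n → Series n) :=
  {V | ∀ i, V i ∈ ringFrom i}

/-- Feed-forward formal vector fields without constant and linear terms:
the generators of near-identity coordinate changes. -/
def fieldsOne (n : ℕ) : Set (Fin n → Series n) :=
  {X | X ∈ fields n ∧ ∀ i, 2 ≤ (X i).order}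

/-- Generators of orbital transformations: one function `rᵢ ∈ ℝ[[xᵢ, …, xₙ]]` without constant
term for each component. -/
def orbitalOne (n : ℕ) : Set (Fin n → Series n) :=
  {r | ∀ i, r i ∈ ringFrom i ∧ MvPowerSeries.constantCoeff (r i) = 0}

/-- The derivative `V(f) = ∑ⱼ Vⱼ ∂f/∂xⱼ` of `f` along `V`. -/
def along {n : ℕ} (V : Fin n → Series n) (f : Series n) : Series n :=
  ∑ j, V j * MvPowerSeries.pderiv ℝ j f

/-- The Lie bracket of formal vector fields, `[X, Y]ᵢ = X(Yᵢ) - Y(Xᵢ)`. -/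
def bracket {n : ℕ} (X Y : Fin n → Series n) : Fin n → Series n :=
  fun i => along X (Y i) - along Y (X i)

/-- `ρ(r, X) Y = r ⋆ Y + [X, Y]`, where `r ⋆ Y` multiplies the `i`-th component of `Y`
by `rᵢ`. -/
def rho {n : ℕ} (r X Y : Fin n → Series n) : Fin n → Series n :=
  fun i => r i * Y i + bracket X Y i

/-- `exp(ρ(r, X)) V = ∑ₖ ρ(r, X)ᵏ V / k!`, coefficient by coefficient. For `r ∈ orbitalOne n` and
`X ∈ fieldsOne n` the operator `ρ(r, X)` raises the degree, so that only finitely many `k`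
contribute to each coefficient. -/
def expRho {n : ℕ} (r X V : Fin n → Series n) : Fin n → Series n :=
  fun i d => ∑ᶠ k : ℕ, ((k.factorial : ℝ)⁻¹) * MvPowerSeries.coeff d (((rho r X)^[k] V) i)

/-- `V'` is obtained from `V` by one transformation `exp(ρ(r, X))`. -/
def OuterStep {n : ℕ} (V V' : Fin n → Series n) : Prop :=
  ∃ r ∈ orbitalOne n, ∃ X ∈ fieldsOne n, V' = expRho r X V

/-- Near-identity feed-forward formal maps `y = φ(x)`, `φᵢ = xᵢ + (order ≥ 2)` in
`ℝ[[xᵢ, …, xₙ]]`. -/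
def maps (n : ℕ) : Set (Fin n → Series n) :=
  {φ | ∀ i, φ i ∈ ringFrom i ∧ 2 ≤ (φ i - MvPowerSeries.X i).order}

/-- `φ` and `ψ` are mutually inverse formal maps. -/
def AreInverse {n : ℕ} (φ ψ : Fin n → Series n) : Prop :=
  ∀ i, MvPowerSeries.subst φ (ψ i) = MvPowerSeries.X i ∧
    MvPowerSeries.subst ψ (φ i) = MvPowerSeries.X i

/-- The coordinate change `y = φ(x)` turns `ẋ = V(x)` into `ẏ = V'(y)`:
`V'ᵢ(φ(x)) = ∑ⱼ Vⱼ(x) ∂φᵢ/∂xⱼ(x)`. -/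
def TurnsInto {n : ℕ} (φ V V' : Fin n → Series n) : Prop :=
  ∀ i, MvPowerSeries.subst φ (V' i) = along V (φ i)

/-- The system `ẋ₁ = x₂ + F₁`, `ẋ₂ = x₃ + F₂`, `ẋ₃ = F₃`. -/
def system (F₁ F₂ F₃ : Series 3) : Fin 3 → Series 3 :=
  ![MvPowerSeries.X 1 + F₁, MvPowerSeries.X 2 + F₂, F₃]

/-- The system `ẋ₁ = x₂ + a x₁²`, `ẋ₂ = x₃ + b x₂²`, `ẋ₃ = c x₃²`. -/
def normalForm (a b c : ℝ) : Fin 3 → Series 3 :=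
  system (MvPowerSeries.C a * MvPowerSeries.X 0 ^ 2) (MvPowerSeries.C b * MvPowerSeries.X 1 ^ 2)
    (MvPowerSeries.C c * MvPowerSeries.X 2 ^ 2)

end FeedForward

end

/-!
If `V(φᵢ) = uᵢ · Wᵢ(φ)` for a near-identity feed-forward map `φ` and feed-forward functions `uᵢ`
with `uᵢ(0) = 1`, then the coordinate change `φ` followed by a rescaling of time in each component
turns `V` into `W`. Since `ρ(0, X)` and `ρ(r, 0)` raise the degree, successive approximation in the
complete filtration by order shows that every such `φ` and `u` comes from an exponential.

For `W` the normal form these equations are solved from the last component upwards and degree by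
degree. In each degree a remainder without a pure power of `xᵢ` lies in the ideal of the later
variables and is absorbed into `uᵢ` and `φᵢ`. The coefficient of the pure power is adjusted by the
corrections `c xᵢᵏ⁺¹` of `φᵢ` and `c (k + 1) xᵢᵏ` of `uᵢ`, whose lower order effects cancel, while
the coefficient of `xᵢᵏ⁺²` changes by `-2 a c` with `a` the coefficient of `xᵢ²` in `Wᵢ`.

For uniqueness, let `Vᵢ` vanish to order `m` on the `xᵢ`-axis for all `i`. Then `ρ(r, X) V` vanishes
there to order `m + 1`, because feed-forward components with larger index vanish on that axis. With
`m = 2` the coefficients of `xᵢ²` in `Vᵢ` are invariant.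
-/

noncomputable section

namespace FeedForward

open Finset

section Filtration

variable {R E : Type*} [Ring R] [AddCommGroup E] [Module R E] {F : ℕ → Submodule R E}

/-- A decreasing exhaustive filtration of a module by submodules `F N` that is separated and
complete. Its members play the role of neighbourhoods of `0`. -/
structure IsCompleteFiltration (F : ℕ → Submodule R E) : Prop where
  anti : Antitone F
  zero : F 0 = ⊤
  separated : ∀ f, (∀ N, f ∈ F N) → f = 0
  complete : ∀ s : ℕ → E, (∀ N, s (N + 1) - s N ∈ F N) → ∃ l, ∀ N, l - s N ∈ F N

/-- The submodule `C` is closed in the topology of the filtration `F`. -/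
def IsClosedFor (F : ℕ → Submodule R E) (C : Submodule R E) : Prop :=
  ∀ l, (∀ N, ∃ c ∈ C, l - c ∈ F N) → l ∈ C

/-- The operator `T` raises the filtration degree by at least one. -/
def Raises (F : ℕ → Submodule R E) (T : Module.End R E) : Prop :=
  ∀ N, ∀ f ∈ F N, T f ∈ F (N + 1)

lemma IsCompleteFiltration.mem_zero (hF : IsCompleteFiltration F) (f : E) : f ∈ F 0 := by
  simp [hF.zero]

lemma IsCompleteFiltration.eq_of_sub_mem (hF : IsCompleteFiltration F) {f g : E}
    (h : ∀ N, f - g ∈ F N) : f = g :=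
  sub_eq_zero.1 (hF.separated _ h)

lemma isClosedFor_of_le {C : Submodule R E} {N : ℕ} (h : F N ≤ C) : IsClosedFor F C :=
    fun l hl => by
  obtain ⟨c, hc, hlc⟩ := hl N
  simpa using C.add_mem (h hlc) hc

lemma isClosedFor_self (F : ℕ → Submodule R E) (N : ℕ) : IsClosedFor F (F N) :=
  isClosedFor_of_le le_rfl

lemma IsClosedFor.inf {C C' : Submodule R E} (hC : IsClosedFor F C) (hC' : IsClosedFor F C') :
    IsClosedFor F (C ⊓ C') := fun l h =>
  ⟨hC l fun N => (h N).imp fun _ hc => ⟨hc.1.1, hc.2⟩,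
    hC' l fun N => (h N).imp fun _ hc => ⟨hc.1.2, hc.2⟩⟩

lemma IsCompleteFiltration.exists_limit (hF : IsCompleteFiltration F) {P : ℕ → E → Prop} {x₀ : E}
    (h₀ : P 0 x₀) (hstep : ∀ N x, P N x → ∃ x', P (N + 1) x' ∧ x' - x ∈ F N) :
    ∃ l, ∀ N, ∃ x, P N x ∧ l - x ∈ F N := by
  choose! next hnext hsub using hstep
  let s : ℕ → E := Nat.rec x₀ next
  have hs : ∀ N, P N (s N) := Nat.rec h₀ fun N => hnext N (s N)
  obtain ⟨l, hl⟩ := hF.complete s fun N => hsub N _ (hs N)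
  exact ⟨l, fun N => ⟨s N, hs N, hl N⟩⟩

variable {ι : Type*} {M : ι → Type*} [∀ i, AddCommGroup (M i)] [∀ i, Module R (M i)]

/-- The componentwise filtration of a product of filtered modules. -/
def piFiltration (F : ∀ i, ℕ → Submodule R (M i)) (N : ℕ) : Submodule R (∀ i, M i) :=
  Submodule.pi Set.univ fun i => F i N

lemma mem_piFiltration {F : ∀ i, ℕ → Submodule R (M i)} {N : ℕ} {f : ∀ i, M i} :
    f ∈ piFiltration F N ↔ ∀ i, f i ∈ F i N := by
  simp [piFiltration]

lemma IsCompleteFiltration.pi {F : ∀ i, ℕ → Submodule R (M i)}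
    (hF : ∀ i, IsCompleteFiltration (F i)) : IsCompleteFiltration (piFiltration F) where
  anti _ _ h _ hf i hi := (hF i).anti h (hf i hi)
  zero := by simp [piFiltration, (hF _).zero]
  separated f h := funext fun i => (hF i).separated _ fun N => h N i trivial
  complete s hs := by
    choose l hl using fun i => (hF i).complete (fun N => s N i) fun N => hs N i trivial
    exact ⟨l, fun N i _ => hl i N⟩

lemma IsClosedFor.pi {F : ∀ i, ℕ → Submodule R (M i)} {C : ∀ i, Submodule R (M i)}
    (hC : ∀ i, IsClosedFor (F i) (C i)) :
    IsClosedFor (piFiltration F) (Submodule.pi Set.univ C) := fun l h i _ =>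
  hC i _ fun N => by
    obtain ⟨c, hc, hlc⟩ := h N
    exact ⟨c i, hc i trivial, hlc i trivial⟩

lemma IsCompleteFiltration.prod {E' : Type*} [AddCommGroup E'] [Module R E']
    {F' : ℕ → Submodule R E'} (hF : IsCompleteFiltration F) (hF' : IsCompleteFiltration F') :
    IsCompleteFiltration fun N => (F N).prod (F' N) where
  anti _ _ h := Submodule.prod_mono (hF.anti h) (hF'.anti h)
  zero := by simp [hF.zero, hF'.zero]
  separated f h := Prod.ext (hF.separated _ fun N => (h N).1) (hF'.separated _ fun N => (h N).2)
  complete s hs := by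
    obtain ⟨l, hl⟩ := hF.complete (fun N => (s N).1) fun N => (hs N).1
    obtain ⟨l', hl'⟩ := hF'.complete (fun N => (s N).2) fun N => (hs N).2
    exact ⟨(l, l'), fun N => ⟨hl N, hl' N⟩⟩

end Filtration

section Raises

variable {R E : Type*} [Ring R] [AddCommGroup E] [Module R E] {F : ℕ → Submodule R E}
  {T : Module.End R E}

lemma Raises.pow_mem (hT : Raises F T) {N : ℕ} {f : E} (hf : f ∈ F N) (k : ℕ) :
    (T ^ k) f ∈ F (N + k) := by
  induction k with
  | zero => simpa using hf
  | succ k ih => rw [pow_succ', Module.End.mul_apply]; exact hT _ _ ih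

lemma Raises.pow_mem_self (hF : IsCompleteFiltration F) (hT : Raises F T) (f : E) (k : ℕ) :
    (T ^ k) f ∈ F k := by
  simpa using hT.pow_mem (hF.mem_zero f) k

lemma Raises.neg (hT : Raises F T) : Raises F (-T) := fun N f hf =>
  (F (N + 1)).neg_mem (hT N f hf)

end Raises

section Exponential

variable {𝕜 E : Type*} [Field 𝕜] [AddCommGroup E] [Module 𝕜 E] {F : ℕ → Submodule 𝕜 E}
  {T : Module.End 𝕜 E} {f g e e' : E}

/-- The partial sums `∑_{k < N} Tᵏ f / k!` of the exponential series. -/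
def expSum (T : Module.End 𝕜 E) (f : E) (N : ℕ) : E :=
  ∑ k ∈ range N, (k.factorial : 𝕜)⁻¹ • (T ^ k) f

/-- `e = exp(T) f`, for operators `T` that raise the degree: the partial sum of order `N` of the
exponential series agrees with `e` up to degree `N`. -/
def HasExp (F : ℕ → Submodule 𝕜 E) (T : Module.End 𝕜 E) (f e : E) : Prop :=
  ∀ N, e - expSum T f N ∈ F N

lemma expSum_succ (T : Module.End 𝕜 E) (f : E) (N : ℕ) :
    expSum T f (N + 1) = f + ∑ k ∈ range N, ((k + 1).factorial : 𝕜)⁻¹ • (T ^ (k + 1)) f := by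
  simp [expSum, sum_range_succ' _ N, add_comm]

lemma HasExp.unique (hF : IsCompleteFiltration F) (h : HasExp F T f e) (h' : HasExp F T f e') :
    e = e' :=
  hF.eq_of_sub_mem fun N => by simpa using (F N).sub_mem (h N) (h' N)

lemma exists_hasExp (hF : IsCompleteFiltration F) (hT : Raises F T) (f : E) :
    ∃ e, HasExp F T f e := by
  refine hF.complete (expSum T f) fun N => ?_
  rw [expSum, expSum, sum_range_succ, add_sub_cancel_left]
  exact (F N).smul_mem _ (hT.pow_mem_self hF f N)

lemma HasExp.add (h : HasExp F T f e) (h' : HasExp F T g e') : HasExp F T (f + g) (e + e') :=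
  fun N => by
    simpa [expSum, sum_add_distrib, add_sub_add_comm] using (F N).add_mem (h N) (h' N)

lemma HasExp.smul (c : 𝕜) (h : HasExp F T f e) : HasExp F T (c • f) (c • e) := fun N => by
  simpa [expSum, smul_sub, smul_sum, smul_comm c] using (F N).smul_mem c (h N)

lemma HasExp.sub_mem {K : Submodule 𝕜 E} (hF : IsCompleteFiltration F) (hK : IsClosedFor F K)
    (hTf : T f ∈ K) (hTK : ∀ g ∈ K, T g ∈ K) (he : HasExp F T f e) : e - f ∈ K := by
  have hpow : ∀ k, (T ^ (k + 1)) f ∈ K := fun k => by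
    induction k with
    | zero => simpa using hTf
    | succ k ih => rw [pow_succ', Module.End.mul_apply]; exact hTK _ ih
  refine hK _ fun N => ⟨∑ k ∈ range N, ((k + 1).factorial : 𝕜)⁻¹ • (T ^ (k + 1)) f,
    K.sum_mem fun k _ => K.smul_mem _ (hpow k), ?_⟩
  rw [sub_sub, ← expSum_succ]
  exact hF.anti N.le_succ (he (N + 1))

lemma HasExp.mem {K : Submodule 𝕜 E} (hF : IsCompleteFiltration F) (hK : IsClosedFor F K)
    (hTK : ∀ g ∈ K, T g ∈ K) (hf : f ∈ K) (he : HasExp F T f e) : e ∈ K := by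
  simpa using K.add_mem (he.sub_mem hF hK (hTK f hf) hTK) hf

lemma HasExp.mem_filtration (hF : IsCompleteFiltration F) (hT : Raises F T) {N : ℕ}
    (hf : f ∈ F N) (he : HasExp F T f e) : e ∈ F N :=
  he.mem hF (isClosedFor_self F N) (fun g hg => hF.anti N.le_succ (hT N g hg)) hf

lemma HasExp.map {E' : Type*} [AddCommGroup E'] [Module 𝕜 E'] {F' : ℕ → Submodule 𝕜 E'}
    {T' : Module.End 𝕜 E'} (L : E →ₗ[𝕜] E') (hL : ∀ N, ∀ x ∈ F N, L x ∈ F' N)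
    (hTT' : ∀ x, L (T x) = T' (L x)) (he : HasExp F T f e) : HasExp F' T' (L f) (L e) := by
  intro N
  have hpow : ∀ k, L ((T ^ k) f) = (T' ^ k) (L f) := fun k => by
    induction k with
    | zero => rfl
    | succ k ih => simp only [pow_succ', Module.End.mul_apply, hTT', ih]
  simpa [expSum, hpow] using hL N _ (he N)

lemma hasExp_piMap {ι : Type*} {M : ι → Type*} [∀ i, AddCommGroup (M i)] [∀ i, Module 𝕜 (M i)]
    {F : ∀ i, ℕ → Submodule 𝕜 (M i)} {T : ∀ i, Module.End 𝕜 (M i)} {f e : ∀ i, M i} :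
    HasExp (piFiltration F) (LinearMap.piMap T) f e ↔ ∀ i, HasExp (F i) (T i) (f i) (e i) := by
  have hpow : ∀ k i, (LinearMap.piMap T ^ k) f i = (T i ^ k) (f i) := fun k i => by
    induction k with
    | zero => rfl
    | succ k ih =>
      rw [pow_succ', pow_succ', Module.End.mul_apply, Module.End.mul_apply, ← ih]
      rfl
  simp only [HasExp, mem_piFiltration, Pi.sub_apply, expSum, Finset.sum_apply, Pi.smul_apply, hpow]
  exact forall_comm

end Exponential

section Leibniz

lemma pow_apply_of_leibniz {R E : Type*} [Semiring R] [AddCommMonoid E] [Module R E]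
    {T : Module.End R E} {a : ℕ → ℕ → E} (hT : ∀ j l, T (a j l) = a (j + 1) l + a j (l + 1))
    (k : ℕ) : (T ^ k) (a 0 0) = ∑ p ∈ antidiagonal k, k.choose p.1 • a p.1 p.2 := by
  induction k with
  | zero => simp
  | succ k ih =>
    rw [sum_antidiagonal_choose_succ_nsmul, pow_succ', Module.End.mul_apply, ih, map_sum,
      add_comm, ← sum_add_distrib]
    refine sum_congr rfl fun p hp => ?_
    rw [← Nat.choose_symm_of_eq_add (HasAntidiagonal.mem_antidiagonal.1 hp).symm, map_nsmul, hT,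
      nsmul_add]

variable {𝕜 E : Type*} [Field 𝕜] [CharZero 𝕜] [AddCommGroup E] [Module 𝕜 E]
  {F : ℕ → Submodule 𝕜 E} {T A B : Module.End 𝕜 E}

lemma inv_factorial_smul_pow_of_leibniz {a : ℕ → ℕ → E}
    (hT : ∀ j l, T (a j l) = a (j + 1) l + a j (l + 1)) (k : ℕ) :
    (k.factorial : 𝕜)⁻¹ • (T ^ k) (a 0 0) =
      ∑ p ∈ antidiagonal k, ((p.1.factorial : 𝕜)⁻¹ * (p.2.factorial : 𝕜)⁻¹) • a p.1 p.2 := by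
  rw [pow_apply_of_leibniz hT, smul_sum]
  refine sum_congr rfl fun p hp => ?_
  obtain rfl := HasAntidiagonal.mem_antidiagonal.1 hp
  rw [← Nat.cast_smul_eq_nsmul 𝕜, smul_smul, Nat.cast_add_choose]
  have := Nat.cast_ne_zero (R := 𝕜).2 (Nat.factorial_ne_zero (p.1 + p.2))
  field_simp

lemma sum_square_sub_expSum_mem (hF : Antitone F) {a : ℕ → ℕ → E}
    (hT : ∀ j l, T (a j l) = a (j + 1) l + a j (l + 1)) (ha : ∀ j l, a j l ∈ F (j + l))
    {N M : ℕ} (hNM : N ≤ M) :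
    ∑ p ∈ range M ×ˢ range M, ((p.1.factorial : 𝕜)⁻¹ * (p.2.factorial : 𝕜)⁻¹) • a p.1 p.2 -
      expSum T (a 0 0) N ∈ F N := by
  have hdiag : expSum T (a 0 0) N = ∑ p ∈ range M ×ˢ range M with p.1 + p.2 < N,
      ((p.1.factorial : 𝕜)⁻¹ * (p.2.factorial : 𝕜)⁻¹) • a p.1 p.2 := by
    rw [expSum, ← sum_fiberwise_of_maps_to (t := range N) (g := fun p : ℕ × ℕ => p.1 + p.2)
      (by simp)]
    refine sum_congr rfl fun k hk => ?_
    rw [inv_factorial_smul_pow_of_leibniz hT]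
    refine sum_congr ?_ fun _ _ => rfl
    ext p
    simp only [HasAntidiagonal.mem_antidiagonal, mem_filter, mem_product, mem_range] at hk ⊢
    lia
  rw [hdiag, ← sum_filter_add_sum_filter_not _ fun p => p.1 + p.2 < N, add_sub_cancel_left]
  exact (F N).sum_mem fun p hp => (F N).smul_mem _ <|
    hF (not_lt.1 (mem_filter.1 hp).2) (ha p.1 p.2)

lemma HasExp.bilin {E₁ E₂ : Type*} [AddCommGroup E₁] [Module 𝕜 E₁] [AddCommGroup E₂]
    [Module 𝕜 E₂] {F₁ : ℕ → Submodule 𝕜 E₁} {F₂ : ℕ → Submodule 𝕜 E₂} {T₁ : Module.End 𝕜 E₁}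
    {T₂ : Module.End 𝕜 E₂} (hF₁ : IsCompleteFiltration F₁) (hF₂ : IsCompleteFiltration F₂)
    (hF : Antitone F) (hT₁ : Raises F₁ T₁) (hT₂ : Raises F₂ T₂) (β : E₁ →ₗ[𝕜] E₂ →ₗ[𝕜] E) {s : ℕ}
    (hβ : ∀ m n, ∀ x ∈ F₁ m, ∀ y ∈ F₂ n, β x y ∈ F (m + n - s))
    (hT : ∀ x y, T (β x y) = β (T₁ x) y + β x (T₂ y)) {x e₁ : E₁} {y e₂ : E₂} (hy : y ∈ F₂ s)
    (h₁ : HasExp F₁ T₁ x e₁) (h₂ : HasExp F₂ T₂ y e₂) : HasExp F T (β x y) (β e₁ e₂) := by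
  intro N
  have hright : β e₁ (e₂ - expSum T₂ y (N + s)) ∈ F N := by
    simpa using hβ 0 (N + s) _ (hF₁.mem_zero e₁) _ (h₂ (N + s))
  have hleft : β (e₁ - expSum T₁ x (N + s)) (expSum T₂ y (N + s)) ∈ F N := by
    simpa using hβ (N + s) 0 _ (h₁ (N + s)) _ (hF₂.mem_zero (expSum T₂ y (N + s)))
  have hsquare := sum_square_sub_expSum_mem hF (T := T)
    (a := fun j l => β ((T₁ ^ j) x) ((T₂ ^ l) y))
    (fun j l => by simp only [hT, pow_succ', Module.End.mul_apply])
    (fun j l => by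
      have := hβ j (s + l) _ (hT₁.pow_mem_self hF₁ x j) _ (hT₂.pow_mem hy l)
      rwa [show j + (s + l) - s = j + l by lia] at this)
    (Nat.le_add_right N s)
  have hprod : β (expSum T₁ x (N + s)) (expSum T₂ y (N + s)) =
      ∑ p ∈ range (N + s) ×ˢ range (N + s), ((p.1.factorial : 𝕜)⁻¹ * (p.2.factorial : 𝕜)⁻¹) •
        β ((T₁ ^ p.1) x) ((T₂ ^ p.2) y) := by
    simp only [expSum, map_sum, LinearMap.sum_apply, map_smul, LinearMap.smul_apply, smul_sum,
      smul_smul, sum_product]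
    rw [sum_comm]
    simp only [mul_comm]
  rw [← hprod] at hsquare
  simpa using (F N).add_mem ((F N).add_mem hright hleft) hsquare

lemma HasExp.add_of_commute (hF : IsCompleteFiltration F) (hA : Raises F A) (hB : Raises F B)
    (hAB : Commute A B) {f e e' : E} (h : HasExp F B f e) (h' : HasExp F A e e') :
    HasExp F (A + B) f e' := by
  intro N
  have hinner : expSum A (e - expSum B f N) N ∈ F N :=
    (F N).sum_mem fun k _ => (F N).smul_mem _ (hF.anti (Nat.le_add_right N k) (hA.pow_mem (h N) k))
  have hsquare := sum_square_sub_expSum_mem hF.anti (T := A + B)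
    (a := fun j l => (A ^ j) ((B ^ l) f))
    (fun j l => by
      have : B * A ^ j = A ^ j * B := (hAB.symm.pow_right j).eq
      simp only [LinearMap.add_apply, pow_succ', Module.End.mul_apply]
      exact congrArg _ (LinearMap.congr_fun this _))
    (fun j l => by simpa [add_comm] using hA.pow_mem (hB.pow_mem_self hF f l) j) le_rfl (N := N)
  have hprod : expSum A (expSum B f N) N = ∑ p ∈ range N ×ˢ range N,
      ((p.1.factorial : 𝕜)⁻¹ * (p.2.factorial : 𝕜)⁻¹) • (A ^ p.1) ((B ^ p.2) f) := by
    simp only [expSum, map_sum, map_smul, smul_sum, smul_smul, sum_product]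
  rw [← hprod] at hsquare
  have hlin : expSum A (e - expSum B f N) N = expSum A e N - expSum A (expSum B f N) N := by
    simp only [expSum, map_sub, smul_sub, sum_sub_distrib]
  rw [hlin] at hinner
  simpa using (F N).add_mem ((F N).add_mem (h' N) hinner) hsquare

lemma HasExp.neg (hF : IsCompleteFiltration F) (hT : Raises F T) {f e : E}
    (h : HasExp F T f e) : HasExp F (-T) e f := by
  obtain ⟨e', he'⟩ := exists_hasExp hF hT.neg e
  have hzero : HasExp F (0 : Module.End 𝕜 E) f e' := by
    simpa using h.add_of_commute hF hT.neg hT (Commute.refl T).neg_left he'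
  have hself : HasExp F (0 : Module.End 𝕜 E) f f := fun N => by
    cases N with
    | zero => exact hF.mem_zero _
    | succ N => simp [expSum_succ]
  exact hzero.unique hF hself ▸ he'

lemma exists_algHom_hasExp {A : Type*} [CommRing A] [Algebra 𝕜 A] {F : ℕ → Submodule 𝕜 A}
    (hF : IsCompleteFiltration F) (hmul : ∀ m n, ∀ f ∈ F m, ∀ g ∈ F n, f * g ∈ F (m + n))
    (D : Derivation 𝕜 A A) (hD : Raises F (D : A →ₗ[𝕜] A)) :
    ∃ ε : A →ₐ[𝕜] A, ∀ f, HasExp F (D : A →ₗ[𝕜] A) f (ε f) := by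
  choose e he using exists_hasExp hF hD
  have hadd : ∀ f g, e (f + g) = e f + e g := fun f g => (he _).unique hF ((he f).add (he g))
  have hmap : ∀ f g, e (f * g) = e f * e g := fun f g =>
    (he _).unique hF <| (he f).bilin (s := 0) hF hF hF.anti hD hD (LinearMap.mul 𝕜 A) hmul
      (fun f g => by simp [mul_comm, add_comm]) (hF.mem_zero g) (he g)
  have hone : e 1 = 1 := by
    have h : e 1 - 1 ∈ (⊥ : Submodule 𝕜 A) :=
      (he 1).sub_mem hF (fun l hl => hF.separated l fun N => by simpa using hl N) (by simp)
        (by simp)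
    simpa [sub_eq_zero] using h
  have hsmul : ∀ (c : 𝕜) f, e (c • f) = c • e f := fun c f => (he _).unique hF ((he f).smul c)
  exact ⟨AlgHom.ofLinearMap ⟨⟨e, hadd⟩, hsmul⟩ hone hmap, he⟩

end Leibniz

section Surjectivity

variable {𝕜 E : Type*} [Field 𝕜] [AddCommGroup E] [Module 𝕜 E] {F : ℕ → Submodule 𝕜 E}
  {T : E →ₗ[𝕜] Module.End 𝕜 E} {s : ℕ} {x₀ : E}

lemma raises_of_mem (hT : ∀ m n, ∀ f ∈ F m, ∀ h ∈ F n, T f h ∈ F (m + n - s)) {f : E}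
    (hf : f ∈ F (s + 1)) : Raises F (T f) := fun N h hh => by
  simpa [show s + 1 + N - s = N + 1 by lia] using hT (s + 1) N f hf h hh

lemma pow_succ_sub_pow_succ_mem (hT : ∀ m n, ∀ f ∈ F m, ∀ h ∈ F n, T f h ∈ F (m + n - s))
    (hTx₀ : ∀ f, T f x₀ = f) (hx₀ : x₀ ∈ F s) {f g : E} (hf : f ∈ F (s + 1)) (hg : g ∈ F (s + 1))
    {N : ℕ} (hfg : f - g ∈ F N) (k : ℕ) :
    (T f ^ (k + 1)) x₀ - (T g ^ (k + 1)) x₀ ∈ F (N + k) := by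
  induction k with
  | zero => simpa [hTx₀] using hfg
  | succ k ih =>
    have hsplit : (T f ^ (k + 2)) x₀ - (T g ^ (k + 2)) x₀ =
        T f ((T f ^ (k + 1)) x₀ - (T g ^ (k + 1)) x₀) + T (f - g) ((T g ^ (k + 1)) x₀) := by
      simp [pow_succ' _ (k + 1)]
    have hright := hT N (s + (k + 1)) _ hfg _ ((raises_of_mem hT hg).pow_mem hx₀ (k + 1))
    rw [show N + (s + (k + 1)) - s = N + (k + 1) by lia] at hright
    rw [hsplit]
    exact (F _).add_mem (raises_of_mem hT hf _ _ ih) hright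

lemma HasExp.sub_sub_sub_mem (hF : IsCompleteFiltration F)
    (hT : ∀ m n, ∀ f ∈ F m, ∀ h ∈ F n, T f h ∈ F (m + n - s))
    (hTx₀ : ∀ f, T f x₀ = f) (hx₀ : x₀ ∈ F s) {f g e e' : E} (hf : f ∈ F (s + 1))
    (hg : g ∈ F (s + 1)) {N : ℕ} (hfg : f - g ∈ F N) (he : HasExp F (T f) x₀ e)
    (he' : HasExp F (T g) x₀ e') : (e - e') - (f - g) ∈ F (N + 1) := by
  have htail : expSum (T f) x₀ (N + 2) - expSum (T g) x₀ (N + 2) - (f - g) ∈ F (N + 1) := by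
    have : expSum (T f) x₀ (N + 2) - expSum (T g) x₀ (N + 2) - (f - g) =
        ∑ k ∈ range N, ((k + 2).factorial : 𝕜)⁻¹ •
          ((T f ^ (k + 2)) x₀ - (T g ^ (k + 2)) x₀) := by
      simp only [expSum_succ, sum_range_succ' _ N, smul_sub, sum_sub_distrib, zero_add, pow_one,
        hTx₀, Nat.factorial_one, Nat.cast_one, inv_one, one_smul, add_assoc, Nat.reduceAdd]
      abel
    rw [this]
    exact (F _).sum_mem fun k _ => (F _).smul_mem _ <|
      hF.anti (by lia) (pow_succ_sub_pow_succ_mem hT hTx₀ hx₀ hf hg hfg (k + 1))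
  have hhead := hF.anti (by lia : N + 1 ≤ N + 2) ((F _).sub_mem (he (N + 2)) (he' (N + 2)))
  convert (F _).add_mem hhead htail using 1
  abel

/-- Solving `exp(T f) x₀ = w` by Newton's scheme `f ↦ f + (w - exp(T f) x₀)`, which gains one
degree of accuracy per step because `exp(T f) x₀ = x₀ + f + ⋯`. -/
lemma exists_hasExp_eq (hF : IsCompleteFiltration F)
    (hT : ∀ m n, ∀ f ∈ F m, ∀ h ∈ F n, T f h ∈ F (m + n - s))
    (hTx₀ : ∀ f, T f x₀ = f) (hx₀ : x₀ ∈ F s) {C : Submodule 𝕜 E} (hC : IsClosedFor F C)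
    (hTC : ∀ f ∈ C, ∀ g ∈ C, T f g ∈ C) (hx₀C : x₀ ∈ C) {w : E} (hwC : w ∈ C)
    (hw : w - x₀ ∈ F (s + 1)) : ∃ f ∈ C, f ∈ F (s + 1) ∧ HasExp F (T f) x₀ w := by
  let P : ℕ → E → Prop := fun N f =>
    f ∈ C ⊓ F (s + 1) ∧ ∃ e, HasExp F (T f) x₀ e ∧ w - e ∈ F N
  have hstart : P 0 0 := by
    obtain ⟨e, he⟩ := exists_hasExp hF (raises_of_mem hT (F (s + 1)).zero_mem) x₀
    exact ⟨Submodule.zero_mem _, e, he, hF.mem_zero _⟩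
  have hstep : ∀ N f, P N f → ∃ f', P (N + 1) f' ∧ f' - f ∈ F N := by
    rintro N f ⟨⟨hfC, hf⟩, e, he, hwe⟩
    have heC : e ∈ C := he.mem hF hC (hTC f hfC) hx₀C
    have hex₀ : e - x₀ ∈ F (s + 1) :=
      he.sub_mem hF (isClosedFor_self F _) (by rwa [hTx₀]) fun g hg =>
        hF.anti (Nat.le_succ _) (raises_of_mem hT hf _ g hg)
    have hf' : f + (w - e) ∈ C ⊓ F (s + 1) :=
      ⟨C.add_mem hfC (C.sub_mem hwC heC), (F _).add_mem hf (by simpa using (F _).sub_mem hw hex₀)⟩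
    obtain ⟨e', he'⟩ := exists_hasExp hF (raises_of_mem hT hf'.2) x₀
    have hgain := HasExp.sub_sub_sub_mem hF hT hTx₀ hx₀ hf'.2 hf (by simpa using hwe) he' he
    refine ⟨f + (w - e), ⟨hf', e', he', ?_⟩, by simpa using hwe⟩
    convert (F _).neg_mem hgain using 1
    abel
  obtain ⟨f, hf⟩ := hF.exists_limit hstart hstep
  have hfC : f ∈ C ⊓ F (s + 1) := hC.inf (isClosedFor_self F _) f fun N =>
    (hf N).imp fun _ h => ⟨h.1.1, h.2⟩
  obtain ⟨e, he⟩ := exists_hasExp hF (raises_of_mem hT hfC.2) x₀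
  suffices w = e from ⟨f, hfC.1, hfC.2, this ▸ he⟩
  refine hF.eq_of_sub_mem fun N => ?_
  obtain ⟨g, ⟨hgC, e', he', hwe'⟩, hfg⟩ := hf N
  have hee' := hF.anti N.le_succ <|
    HasExp.sub_sub_sub_mem hF hT hTx₀ hx₀ hfC.2 hgC.2 hfg he he'
  convert (F N).sub_mem hwe' ((F N).add_mem hee' hfg) using 1
  abel

end Surjectivity

section Order

variable {σ R : Type*} [CommRing R]

/-- Power series of order at least `N`. -/
def orderGE (N : ℕ) : Submodule R (MvPowerSeries σ R) where
  carrier := {f | (N : ℕ∞) ≤ f.order}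
  add_mem' hf hg := (le_min hf hg).trans MvPowerSeries.min_order_le_add
  zero_mem' := by simp
  smul_mem' _ _ hf := le_trans hf MvPowerSeries.le_order_smul

lemma mem_orderGE_iff_order {N : ℕ} {f : MvPowerSeries σ R} :
    f ∈ orderGE N ↔ (N : ℕ∞) ≤ f.order :=
  Iff.rfl

lemma mem_orderGE_iff_coeff {N : ℕ} {f : MvPowerSeries σ R} :
    f ∈ orderGE N ↔ ∀ d : σ →₀ ℕ, d.degree < N → MvPowerSeries.coeff d f = 0 :=
  ⟨fun h _ hd => MvPowerSeries.coeff_of_lt_order (lt_of_lt_of_le (by exact_mod_cast hd) h),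
    MvPowerSeries.nat_le_order⟩

lemma isCompleteFiltration_orderGE :
    IsCompleteFiltration (orderGE : ℕ → Submodule R (MvPowerSeries σ R)) where
  anti _ _ h _ hf := le_trans (by exact_mod_cast h) (mem_orderGE_iff_order.1 hf)
  zero := eq_top_iff.2 fun f _ => by simp [mem_orderGE_iff_order]
  separated f hf := MvPowerSeries.ext fun d =>
    mem_orderGE_iff_coeff.1 (hf (d.degree + 1)) d (Nat.lt_succ_self _)
  complete s hs := by
    have hcoeff : ∀ d k, MvPowerSeries.coeff d (s (d.degree + 1 + k)) =
        MvPowerSeries.coeff d (s (d.degree + 1)) := fun d k => by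
      induction k with
      | zero => rfl
      | succ k ih =>
        rw [← ih, ← sub_eq_zero, ← map_sub]
        exact mem_orderGE_iff_coeff.1 (hs (d.degree + 1 + k)) d (by lia)
    let l : MvPowerSeries σ R := fun d => MvPowerSeries.coeff d (s (d.degree + 1))
    refine ⟨l, fun N => mem_orderGE_iff_coeff.2 fun d hd => ?_⟩
    obtain ⟨k, rfl⟩ := Nat.exists_eq_add_of_le (Nat.succ_le_of_lt hd)
    rw [map_sub, hcoeff]
    exact sub_self _

lemma mem_orderGE_one {f : MvPowerSeries σ R} :
    f ∈ orderGE 1 ↔ MvPowerSeries.constantCoeff f = 0 := by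
  rw [mem_orderGE_iff_order, Nat.cast_one, MvPowerSeries.one_le_order_iff_constCoeff_eq_zero]

lemma mul_mem_orderGE {M N : ℕ} {f g : MvPowerSeries σ R} (hf : f ∈ orderGE M)
    (hg : g ∈ orderGE N) : f * g ∈ orderGE (M + N) :=
  mem_orderGE_iff_order.2 <| by
    simpa using (add_le_add hf hg).trans MvPowerSeries.le_order_mul

lemma mul_mem_orderGE_of_right {N : ℕ} (f : MvPowerSeries σ R) {g : MvPowerSeries σ R}
    (hg : g ∈ orderGE N) : f * g ∈ orderGE N := by
  simpa using mul_mem_orderGE (isCompleteFiltration_orderGE.mem_zero f) hg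

lemma pow_mem_orderGE {N : ℕ} {f : MvPowerSeries σ R} (hf : f ∈ orderGE N) (k : ℕ) :
    f ^ k ∈ orderGE (k * N) :=
  mem_orderGE_iff_order.2 <| by
    simpa using (nsmul_le_nsmul_right hf k).trans (MvPowerSeries.le_order_pow k)

lemma X_mem_orderGE (i : σ) : (MvPowerSeries.X i : MvPowerSeries σ R) ∈ orderGE 1 := by
  simp [mem_orderGE_one]

lemma pderiv_mem_orderGE {N : ℕ} {f : MvPowerSeries σ R} (hf : f ∈ orderGE N) (i : σ) :
    MvPowerSeries.pderiv R i f ∈ orderGE (N - 1) :=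
  mem_orderGE_iff_coeff.2 fun d hd => by
    rw [MvPowerSeries.coeff_pderiv, mem_orderGE_iff_coeff.1 hf _ (by simp; lia), zero_mul]

lemma pderiv_comm (i j : σ) (f : MvPowerSeries σ R) :
    MvPowerSeries.pderiv R i (MvPowerSeries.pderiv R j f) =
      MvPowerSeries.pderiv R j (MvPowerSeries.pderiv R i f) := by
  rcases eq_or_ne i j with rfl | h
  · rfl
  ext d
  simp only [MvPowerSeries.coeff_pderiv, Finsupp.add_apply, Finsupp.single_eq_of_ne h,
    Finsupp.single_eq_of_ne h.symm, add_right_comm d (Finsupp.single i 1)]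
  push_cast
  ring

lemma subst_mem_orderGE {a : σ → MvPowerSeries σ R} (ha : MvPowerSeries.HasSubst a)
    (ha₁ : ∀ i, a i ∈ orderGE 1) {N : ℕ} {f : MvPowerSeries σ R} (hf : f ∈ orderGE N) :
    MvPowerSeries.subst a f ∈ orderGE N :=
  hf.trans <| (le_mul_of_one_le_left zero_le <| le_iInf fun i => by
    simpa using mem_orderGE_iff_order.1 (ha₁ i)).trans (MvPowerSeries.le_order_subst ha f)

lemma sub_truncTotal_mem_orderGE [Finite σ] (f : MvPowerSeries σ R) (N : ℕ) :
    f - (f.truncTotal N : MvPowerSeries σ R) ∈ orderGE N :=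
  mem_orderGE_iff_coeff.2 fun d hd => by
    rw [map_sub, MvPolynomial.coeff_coe, MvPowerSeries.coeff_truncTotal _ hd, sub_self]

lemma algHom_eq_subst [Finite σ] (ε : MvPowerSeries σ R →ₐ[R] MvPowerSeries σ R)
    (hε : ∀ N, ∀ f ∈ orderGE N, ε f ∈ orderGE N) (f : MvPowerSeries σ R) :
    ε f = MvPowerSeries.subst (fun i => ε (MvPowerSeries.X i)) f := by
  have hX : ∀ i, ε (MvPowerSeries.X i) ∈ orderGE 1 := fun i => hε 1 _ (X_mem_orderGE i)
  have hsubst : MvPowerSeries.HasSubst fun i => ε (MvPowerSeries.X i) :=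
    MvPowerSeries.hasSubst_of_constantCoeff_zero fun i => mem_orderGE_one.1 (hX i)
  have hpoly : ∀ p : MvPolynomial σ R,
      ε p = MvPowerSeries.subst (fun i => ε (MvPowerSeries.X i)) (p : MvPowerSeries σ R) := by
    have hhom : ε.comp (MvPolynomial.coeToMvPowerSeries.algHom R) =
        (MvPowerSeries.substAlgHom (R := R) hsubst).comp
          (MvPolynomial.coeToMvPowerSeries.algHom R) :=
      MvPolynomial.algHom_ext fun i => by
        simp [MvPowerSeries.subst_X hsubst]
    intro p
    simpa using DFunLike.congr_fun hhom p
  refine isCompleteFiltration_orderGE.eq_of_sub_mem fun N => ?_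
  have htail := sub_truncTotal_mem_orderGE f N
  have h := sub_mem (hε N _ htail) (subst_mem_orderGE hsubst hX htail)
  rwa [map_sub, MvPowerSeries.subst_sub hsubst, hpoly, sub_sub_sub_cancel_right] at h

end Order

section FeedForward

variable {n : ℕ}

/-- `ringFrom i` as a subalgebra of all formal power series. -/
def ringFromSubalgebra (i : Fin n) : Subalgebra ℝ (Series n) where
  carrier := ringFrom i
  mul_mem' {f g} hf hg d hd j hj := by
    classical
    rw [MvPowerSeries.coeff_mul] at hd
    obtain ⟨p, hp, hne⟩ := exists_ne_zero_of_sum_ne_zero hd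
    rw [← HasAntidiagonal.mem_antidiagonal.1 hp, Finsupp.add_apply,
      hf _ (left_ne_zero_of_mul hne) j hj, hg _ (right_ne_zero_of_mul hne) j hj]
  add_mem' {f g} hf hg d hd j hj := by
    by_cases h : MvPowerSeries.coeff d f = 0
    · exact hg d (by simpa [h] using hd) j hj
    · exact hf d h j hj
  algebraMap_mem' c d hd j hj := by
    classical
    rw [MvPowerSeries.algebraMap_apply, MvPowerSeries.coeff_C] at hd
    simp [show d = 0 from of_not_not fun h => hd (if_neg h)]

lemma isClosedFor_ringFromSubalgebra (i : Fin n) :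
    IsClosedFor orderGE (Subalgebra.toSubmodule (ringFromSubalgebra i)) := fun l hl d hd j hj => by
  obtain ⟨c, hc, hlc⟩ := hl (d.degree + 1)
  have hcoeff := mem_orderGE_iff_coeff.1 hlc d (Nat.lt_succ_self _)
  rw [map_sub, sub_eq_zero] at hcoeff
  exact hc d (hcoeff ▸ hd) j hj

lemma ringFromSubalgebra_anti : Antitone (ringFromSubalgebra (n := n)) :=
  fun _ _ h _ hf d hd k hk => hf d hd k (hk.trans_le h)

lemma X_mem_ringFrom (i : Fin n) : (MvPowerSeries.X i : Series n) ∈ ringFromSubalgebra i :=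
  fun d hd j hj => by
    classical
    rw [MvPowerSeries.coeff_X] at hd
    rw [show d = Finsupp.single i 1 from of_not_not fun h => hd (if_neg h),
      Finsupp.single_eq_of_ne hj.ne]

lemma pderiv_mem_ringFrom {i : Fin n} {f : Series n} (hf : f ∈ ringFromSubalgebra i)
    (j : Fin n) : MvPowerSeries.pderiv ℝ j f ∈ ringFromSubalgebra i := fun d hd k hk => by
  rw [MvPowerSeries.coeff_pderiv] at hd
  simpa using (Nat.add_eq_zero_iff.1 (hf _ (left_ne_zero_of_mul hd) k hk)).1

lemma pderiv_eq_zero_of_lt {i j : Fin n} {f : Series n} (hf : f ∈ ringFromSubalgebra i)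
    (h : j < i) : MvPowerSeries.pderiv ℝ j f = 0 := MvPowerSeries.ext fun d => by
  rw [MvPowerSeries.coeff_pderiv, map_zero]
  by_contra hd
  simpa using hf _ (left_ne_zero_of_mul hd) j h

/-- `fields n` as a subspace of all formal vector fields. -/
def fieldsSubmodule (n : ℕ) : Submodule ℝ (Fin n → Series n) :=
  Submodule.pi Set.univ fun i => Subalgebra.toSubmodule (ringFromSubalgebra i)

lemma mem_fieldsSubmodule {V : Fin n → Series n} :
    V ∈ fieldsSubmodule n ↔ ∀ i, V i ∈ ringFromSubalgebra i := by
  simp [fieldsSubmodule]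

/-- Families of power series, in particular formal vector fields, all of whose members have order
at least `N`. -/
abbrev vecOrderGE (N : ℕ) : Submodule ℝ (Fin n → Series n) :=
  piFiltration (fun _ => orderGE) N

lemma isCompleteFiltration_vecOrderGE :
    IsCompleteFiltration (vecOrderGE : ℕ → Submodule ℝ (Fin n → Series n)) :=
  IsCompleteFiltration.pi fun _ => isCompleteFiltration_orderGE

lemma isClosedFor_fieldsSubmodule : IsClosedFor vecOrderGE (fieldsSubmodule n) :=
  IsClosedFor.pi isClosedFor_ringFromSubalgebra

end FeedForward

section VectorFields

variable {n : ℕ} {r X Y V : Fin n → Series n} {f g : Series n}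

/-- `along` as a bilinear map. -/
def alongLin : (Fin n → Series n) →ₗ[ℝ] Module.End ℝ (Series n) :=
  LinearMap.mk₂ ℝ along
    (fun V W f => by simp [along, add_mul, sum_add_distrib])
    (fun c V f => by simp [along, smul_sum])
    (fun V f g => by simp [along, mul_add, sum_add_distrib])
    (fun c V f => by simp [along, smul_sum])

@[simp]
lemma alongLin_apply (V : Fin n → Series n) (f : Series n) : alongLin V f = along V f := rfl

/-- The componentwise derivative `Z ↦ (V(Z₁), …, V(Zₙ))` as a bilinear map. -/
def alongPi : (Fin n → Series n) →ₗ[ℝ] Module.End ℝ (Fin n → Series n) where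
  toFun V := LinearMap.piMap fun _ => alongLin V
  map_add' V W := LinearMap.ext fun _ => funext fun _ => by simp
  map_smul' c V := LinearMap.ext fun _ => funext fun _ => by simp

lemma alongPi_apply (V Z : Fin n → Series n) (i : Fin n) : alongPi V Z i = along V (Z i) := rfl

/-- The derivation `f ↦ V(f)`. -/
def alongDer (V : Fin n → Series n) : Derivation ℝ (Series n) (Series n) :=
  Derivation.mk' (alongLin V) fun f g => by
    simp only [alongLin_apply, along, Derivation.leibniz, smul_eq_mul, mul_sum, ← sum_add_distrib]
    exact sum_congr rfl fun j _ => by ring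

lemma along_mul (V : Fin n → Series n) (f g : Series n) :
    along V (f * g) = f * along V g + g * along V f :=
  (alongDer V).leibniz f g

lemma along_X (V : Fin n → Series n) (i : Fin n) : along V (MvPowerSeries.X i) = V i := by
  classical
  simp [along, MvPowerSeries.pderiv_X, Pi.single_apply]

lemma along_mem_orderGE {M N : ℕ} (hV : V ∈ vecOrderGE M) (hf : f ∈ orderGE N) :
    along V f ∈ orderGE (M + N - 1) :=
  (orderGE _).sum_mem fun j _ => isCompleteFiltration_orderGE.anti (by lia)
    (mul_mem_orderGE (mem_piFiltration.1 hV j) (pderiv_mem_orderGE hf j))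

lemma raises_alongLin (hX : X ∈ vecOrderGE 2) : Raises orderGE (alongLin X) := fun N f hf => by
  simpa [show 2 + N - 1 = N + 1 by lia] using along_mem_orderGE hX hf

lemma along_mem_ringFrom (hX : X ∈ fieldsSubmodule n) {i : Fin n}
    (hf : f ∈ ringFromSubalgebra i) : along X f ∈ ringFromSubalgebra i :=
  (ringFromSubalgebra i).sum_mem fun j _ => by
    rcases lt_or_ge j i with h | h
    · rw [pderiv_eq_zero_of_lt hf h, mul_zero]
      exact (ringFromSubalgebra i).zero_mem
    · exact (ringFromSubalgebra i).mul_mem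
        (ringFromSubalgebra_anti h (mem_fieldsSubmodule.1 hX j)) (pderiv_mem_ringFrom hf j)

lemma along_along (X Y : Fin n → Series n) (f : Series n) : along X (along Y f) =
    ∑ j, along X (Y j) * MvPowerSeries.pderiv ℝ j f +
      ∑ j, ∑ k, Y j * X k * MvPowerSeries.pderiv ℝ k (MvPowerSeries.pderiv ℝ j f) := by
  rw [along.eq_1 Y, ← alongLin_apply, map_sum, ← sum_add_distrib]
  refine sum_congr rfl fun j _ => ?_
  rw [alongLin_apply, along_mul, add_comm, mul_comm, along.eq_1 X (MvPowerSeries.pderiv ℝ j f)]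
  simp only [mul_sum, mul_assoc]

lemma along_bracket (X Y : Fin n → Series n) (f : Series n) :
    along (bracket X Y) f = along X (along Y f) - along Y (along X f) := by
  have hsymm : ∑ j, ∑ k, X j * Y k * MvPowerSeries.pderiv ℝ k (MvPowerSeries.pderiv ℝ j f) =
      ∑ j, ∑ k, Y j * X k * MvPowerSeries.pderiv ℝ k (MvPowerSeries.pderiv ℝ j f) := by
    rw [sum_comm]
    refine sum_congr rfl fun j _ => sum_congr rfl fun k _ => ?_
    rw [pderiv_comm, mul_comm (X k)]
  rw [along_along X Y, along_along Y X, hsymm, add_sub_add_right_eq_sub, ← sum_sub_distrib]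
  exact sum_congr rfl fun j _ => sub_mul _ _ _

/-- `ρ(r, X)` as a linear operator. -/
def rhoLin (r X : Fin n → Series n) : Module.End ℝ (Fin n → Series n) :=
  LinearMap.pi fun i => LinearMap.mulLeft ℝ (r i) ∘ₗ LinearMap.proj i +
    (alongLin X ∘ₗ LinearMap.proj i - alongLin.flip (X i))

lemma coe_rhoLin (r X : Fin n → Series n) : ⇑(rhoLin r X) = rho r X := rfl

lemma rhoLin_neg (r X : Fin n → Series n) : rhoLin (-r) (-X) = -rhoLin r X :=
  LinearMap.ext fun Y => funext fun i => by
    simp only [rhoLin, LinearMap.pi_apply, LinearMap.add_apply, LinearMap.comp_apply,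
      LinearMap.sub_apply, LinearMap.neg_apply, LinearMap.mulLeft_apply, LinearMap.flip_apply,
      Pi.neg_apply, map_neg]
    ring

lemma raises_rhoLin (hr : r ∈ vecOrderGE 1) (hX : X ∈ vecOrderGE 2) :
    Raises vecOrderGE (rhoLin r X) := fun N Y hY => mem_piFiltration.2 fun i => by
  have hYi := mem_piFiltration.1 hY i
  refine add_mem ?_ (sub_mem (raises_alongLin hX N _ hYi) ?_)
  · rw [add_comm N]
    exact mul_mem_orderGE (mem_piFiltration.1 hr i) hYi
  · exact along_mem_orderGE hY (mem_piFiltration.1 hX i)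

lemma hasExp_expRho (hr : r ∈ vecOrderGE 1) (hX : X ∈ vecOrderGE 2) (V : Fin n → Series n) :
    HasExp vecOrderGE (rhoLin r X) V (expRho r X V) := fun N =>
  mem_piFiltration.2 fun i => mem_orderGE_iff_coeff.2 fun d hd => by
    have hpow : ∀ k, (rho r X)^[k] V = (rhoLin r X ^ k) V := fun k => by
      rw [Module.End.pow_apply, coe_rhoLin]
    have hvanish : ∀ k, N ≤ k → MvPowerSeries.coeff d ((rhoLin r X ^ k) V i) = 0 := fun k hk =>
      mem_orderGE_iff_coeff.1 (mem_piFiltration.1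
        ((raises_rhoLin hr hX).pow_mem_self isCompleteFiltration_vecOrderGE V k) i) d
        (hd.trans_le hk)
    have hfinite : MvPowerSeries.coeff d (expRho r X V i) =
        ∑ k ∈ range N, (k.factorial : ℝ)⁻¹ * MvPowerSeries.coeff d ((rhoLin r X ^ k) V i) := by
      simp only [← hpow] at hvanish ⊢
      refine finsum_eq_sum_of_support_subset _ fun k hk => ?_
      by_contra hkN
      exact hk (by simp [hvanish k (by simpa using hkN)])
    simp [hfinite, expSum, Finset.sum_apply]

lemma rhoLin_mem_fieldsSubmodule (hr : r ∈ fieldsSubmodule n) (hX : X ∈ fieldsSubmodule n)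
    (hY : Y ∈ fieldsSubmodule n) : rhoLin r X Y ∈ fieldsSubmodule n :=
  mem_fieldsSubmodule.2 fun i => by
    have hYi := mem_fieldsSubmodule.1 hY i
    exact add_mem (mul_mem (mem_fieldsSubmodule.1 hr i) hYi) <| sub_mem
      (along_mem_ringFrom hX hYi) (along_mem_ringFrom hY (mem_fieldsSubmodule.1 hX i))

lemma mem_orbitalOne : r ∈ orbitalOne n ↔ r ∈ fieldsSubmodule n ∧ r ∈ vecOrderGE 1 := by
  simp only [mem_fieldsSubmodule, mem_piFiltration, mem_orderGE_one, ← forall_and]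
  rfl

lemma mem_fieldsOne : X ∈ fieldsOne n ↔ X ∈ fieldsSubmodule n ∧ X ∈ vecOrderGE 2 := by
  simp only [mem_fieldsSubmodule, mem_piFiltration]
  rfl

lemma expRho_neg_expRho (hr : r ∈ vecOrderGE 1) (hX : X ∈ vecOrderGE 2)
    (V : Fin n → Series n) : expRho (-r) (-X) (expRho r X V) = V :=
  (rhoLin_neg r X ▸ hasExp_expRho (neg_mem hr) (neg_mem hX) (expRho r X V)).unique
    isCompleteFiltration_vecOrderGE <|
    (hasExp_expRho hr hX V).neg isCompleteFiltration_vecOrderGE (raises_rhoLin hr hX)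

lemma mapsTo_expRho (hr : r ∈ orbitalOne n) (hX : X ∈ fieldsOne n) :
    Set.MapsTo (expRho r X) (fields n) (fields n) := fun V hV => by
  rw [mem_orbitalOne] at hr
  rw [mem_fieldsOne] at hX
  exact mem_fieldsSubmodule.1 <| (hasExp_expRho hr.2 hX.2 V).mem isCompleteFiltration_vecOrderGE
    isClosedFor_fieldsSubmodule (fun Y => rhoLin_mem_fieldsSubmodule hr.1 hX.1)
    (mem_fieldsSubmodule.2 hV)

lemma bijOn_expRho (hr : r ∈ orbitalOne n) (hX : X ∈ fieldsOne n) :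
    Set.BijOn (expRho r X) (fields n) (fields n) := by
  have hr' := mem_orbitalOne.1 hr
  have hX' := mem_fieldsOne.1 hX
  have hrn : -r ∈ orbitalOne n := mem_orbitalOne.2 ⟨neg_mem hr'.1, neg_mem hr'.2⟩
  have hXn : -X ∈ fieldsOne n := mem_fieldsOne.2 ⟨neg_mem hX'.1, neg_mem hX'.2⟩
  refine Set.InvOn.bijOn ⟨fun V _ => expRho_neg_expRho hr'.2 hX'.2 V, fun V _ => ?_⟩
    (mapsTo_expRho hr hX) (mapsTo_expRho hrn hXn)
  simpa using expRho_neg_expRho (neg_mem hr'.2) (neg_mem hX'.2) V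

end VectorFields

section CoordinateChanges

variable {n : ℕ} {Y φ ψ : Fin n → Series n} {i : Fin n}

lemma exists_hasExp_X_eq (hφ : φ ∈ maps n) :
    ∃ Y ∈ fieldsOne n, ∀ i, HasExp orderGE (alongLin Y) (MvPowerSeries.X i) (φ i) := by
  have hT : ∀ M N, ∀ Y ∈ vecOrderGE M, ∀ Z ∈ vecOrderGE N,
      alongPi Y Z ∈ vecOrderGE (n := n) (M + N - 1) := fun M N Y hY Z hZ =>
    mem_piFiltration.2 fun i => along_mem_orderGE hY (mem_piFiltration.1 hZ i)
  have hTfields : ∀ Y ∈ fieldsSubmodule n, ∀ Z ∈ fieldsSubmodule n,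
      alongPi Y Z ∈ fieldsSubmodule n := fun Y hY Z hZ =>
    mem_fieldsSubmodule.2 fun i => along_mem_ringFrom hY (mem_fieldsSubmodule.1 hZ i)
  have hφ₂ : φ - MvPowerSeries.X ∈ vecOrderGE 2 :=
    mem_piFiltration.2 fun i => mem_orderGE_iff_order.2 (hφ i).2
  obtain ⟨Y, hY, hY₂, hexp⟩ := exists_hasExp_eq (F := vecOrderGE) (T := alongPi) (s := 1)
    (x₀ := MvPowerSeries.X) isCompleteFiltration_vecOrderGE hT
    (fun Y => funext fun i => by rw [alongPi_apply, along_X]) (mem_piFiltration.2 X_mem_orderGE)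
    isClosedFor_fieldsSubmodule hTfields (mem_fieldsSubmodule.2 X_mem_ringFrom)
    (mem_fieldsSubmodule.2 fun i => (hφ i).1) hφ₂
  exact ⟨Y, mem_fieldsOne.2 ⟨hY, hY₂⟩, hasExp_piMap.1 hexp⟩

lemma mem_maps_of_hasExp (hY : Y ∈ fieldsOne n)
    (h : ∀ i, HasExp orderGE (alongLin Y) (MvPowerSeries.X i) (φ i)) : φ ∈ maps n := fun i => by
  obtain ⟨hY, hY₂⟩ := mem_fieldsOne.1 hY
  exact ⟨(h i).mem isCompleteFiltration_orderGE (isClosedFor_ringFromSubalgebra i)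
      (fun f => along_mem_ringFrom hY) (X_mem_ringFrom i),
    (h i).sub_mem isCompleteFiltration_orderGE (isClosedFor_self _ 2)
      (by simpa [along_X] using mem_piFiltration.1 hY₂ i) fun f hf =>
        isCompleteFiltration_orderGE.anti (by lia) (raises_alongLin hY₂ 2 f hf)⟩

lemma mem_orderGE_one_of_mem_maps (hφ : φ ∈ maps n) (i : Fin n) : φ i ∈ orderGE 1 := by
  simpa using add_mem (isCompleteFiltration_orderGE.anti one_le_two
    (mem_orderGE_iff_order.2 (hφ i).2)) (X_mem_orderGE i)

lemma hasSubst_of_mem_maps (hφ : φ ∈ maps n) : MvPowerSeries.HasSubst φ :=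
  MvPowerSeries.hasSubst_of_constantCoeff_zero fun i =>
    mem_orderGE_one.1 (mem_orderGE_one_of_mem_maps hφ i)

lemma hasExp_subst (hY : Y ∈ vecOrderGE 2)
    (h : ∀ i, HasExp orderGE (alongLin Y) (MvPowerSeries.X i) (φ i)) (f : Series n) :
    HasExp orderGE (alongLin Y) f (MvPowerSeries.subst φ f) := by
  obtain ⟨ε, hε⟩ : ∃ ε : Series n →ₐ[ℝ] Series n, ∀ f, HasExp orderGE (alongLin Y) f (ε f) :=
    exists_algHom_hasExp (F := orderGE) isCompleteFiltration_orderGE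
      (fun _ _ _ hf _ hg => mul_mem_orderGE hf hg) (alongDer Y) (raises_alongLin hY)
  have hφ : (fun i => ε (MvPowerSeries.X i)) = φ :=
    funext fun i => (hε _).unique isCompleteFiltration_orderGE (h i)
  rw [← hφ, ← algHom_eq_subst ε fun N f =>
    (hε f).mem_filtration isCompleteFiltration_orderGE (raises_alongLin hY)]
  exact hε f

lemma subst_mem_ringFrom (hφ : φ ∈ maps n) {f : Series n} (hf : f ∈ ringFromSubalgebra i) :
    MvPowerSeries.subst φ f ∈ ringFromSubalgebra i := by
  obtain ⟨Y, hY, hexp⟩ := exists_hasExp_X_eq hφ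
  obtain ⟨hY, hY₂⟩ := mem_fieldsOne.1 hY
  exact (hasExp_subst hY₂ hexp f).mem isCompleteFiltration_orderGE
    (isClosedFor_ringFromSubalgebra i) (fun g => along_mem_ringFrom hY) hf

lemma subst_eq_X_of_hasExp (hY : Y ∈ vecOrderGE 2)
    (hφ : ∀ i, HasExp orderGE (alongLin Y) (MvPowerSeries.X i) (φ i))
    (hψ : ∀ i, HasExp orderGE (alongLin (-Y)) (MvPowerSeries.X i) (ψ i)) (i : Fin n) :
    MvPowerSeries.subst φ (ψ i) = MvPowerSeries.X i := by
  have hinv := (hψ i).neg isCompleteFiltration_orderGE (raises_alongLin (neg_mem hY))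
  rw [map_neg, neg_neg] at hinv
  exact (hasExp_subst hY hφ (ψ i)).unique isCompleteFiltration_orderGE hinv

lemma turnsInto_expRho (hY : Y ∈ vecOrderGE 2)
    (h : ∀ i, HasExp orderGE (alongLin Y) (MvPowerSeries.X i) (φ i)) (V : Fin n → Series n) :
    TurnsInto φ V (expRho 0 (-Y) V) := fun i => by
  have hback : HasExp vecOrderGE (rhoLin 0 Y) (expRho 0 (-Y) V) V := by
    have := (hasExp_expRho (zero_mem _) (neg_mem hY) V).neg isCompleteFiltration_vecOrderGE
      (raises_rhoLin (zero_mem _) (neg_mem hY))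
    rwa [← rhoLin_neg, neg_neg, neg_zero] at this
  have hleibniz : ∀ Z f, along Y (along Z f) = along (rhoLin 0 Y Z) f + along Z (along Y f) :=
    fun Z f => by
      rw [show rhoLin 0 Y Z = bracket Y Z from funext fun i => by simp [coe_rhoLin, rho],
        along_bracket, sub_add_cancel]
  have hV := hback.bilin (T := alongLin Y) isCompleteFiltration_vecOrderGE
    isCompleteFiltration_orderGE isCompleteFiltration_orderGE.anti
    (raises_rhoLin (zero_mem _) hY) (raises_alongLin hY) alongLin
    (fun M N V hV f hf => along_mem_orderGE hV hf) hleibniz (X_mem_orderGE i) (h i)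
  rw [alongLin_apply, along_X] at hV
  exact (hasExp_subst hY h _).unique isCompleteFiltration_orderGE hV

lemma exists_turnsInto_expRho (hφ : φ ∈ maps n) : ∃ X ∈ fieldsOne n, ∃ ψ ∈ maps n,
    AreInverse φ ψ ∧ ∀ V, TurnsInto φ V (expRho 0 X V) := by
  obtain ⟨Y, hY, hexp⟩ := exists_hasExp_X_eq hφ
  obtain ⟨hYf, hY₂⟩ := mem_fieldsOne.1 hY
  have hnegY : -Y ∈ fieldsOne n := mem_fieldsOne.2 ⟨neg_mem hYf, neg_mem hY₂⟩
  choose ψ hψ using fun i => exists_hasExp isCompleteFiltration_orderGE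
    (raises_alongLin (neg_mem hY₂)) (MvPowerSeries.X i)
  exact ⟨-Y, hnegY, ψ, mem_maps_of_hasExp hnegY hψ, fun i =>
    ⟨subst_eq_X_of_hasExp hY₂ hexp hψ i,
      subst_eq_X_of_hasExp (neg_mem hY₂) hψ (by rwa [neg_neg]) i⟩,
    turnsInto_expRho hY₂ hexp⟩

lemma subst_subst_of_areInverse (hφ : φ ∈ maps n) (hψ : ψ ∈ maps n) (h : AreInverse φ ψ)
    (f : Series n) : MvPowerSeries.subst ψ (MvPowerSeries.subst φ f) = f := by
  rw [MvPowerSeries.subst_comp_subst_apply (hasSubst_of_mem_maps hφ) (hasSubst_of_mem_maps hψ),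
    funext fun i => (h i).2, MvPowerSeries.subst_self, id]

end CoordinateChanges

section TimeRescaling

variable {n : ℕ} {w u φ V W : Fin n → Series n} {i : Fin n}

lemma exists_hasExp_one_eq {w : Series n} (hw : w ∈ ringFromSubalgebra i)
    (hw₁ : w - 1 ∈ orderGE 1) : ∃ r ∈ ringFromSubalgebra i, r ∈ orderGE 1 ∧
      HasExp orderGE (LinearMap.mulLeft ℝ r) 1 w :=
  exists_hasExp_eq (F := orderGE) (T := LinearMap.mul ℝ (Series n)) (s := 0)
    isCompleteFiltration_orderGE (fun _ _ _ hf _ hg => mul_mem_orderGE hf hg) mul_one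
    (isCompleteFiltration_orderGE.mem_zero 1)
    (isClosedFor_ringFromSubalgebra i) (fun _ hf _ hg => (ringFromSubalgebra i).mul_mem hf hg)
    (ringFromSubalgebra i).one_mem hw hw₁

lemma exists_expRho_mul_eq (hw : w ∈ fieldsSubmodule n) (hw₁ : w - 1 ∈ vecOrderGE 1) :
    ∃ r ∈ orbitalOne n, ∀ V, expRho r 0 (w * V) = V := by
  choose r hr hr₁ hexp using fun i =>
    exists_hasExp_one_eq (mem_fieldsSubmodule.1 hw i) (mem_piFiltration.1 hw₁ i)
  have hr₁' : r ∈ vecOrderGE 1 := mem_piFiltration.2 hr₁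
  have hrn : -r ∈ orbitalOne n :=
    mem_orbitalOne.2 ⟨neg_mem (mem_fieldsSubmodule.2 hr), neg_mem hr₁'⟩
  refine ⟨-r, hrn, fun V => ?_⟩
  have hmul : HasExp vecOrderGE (rhoLin r 0) V (w * V) := by
    rw [show rhoLin r 0 = LinearMap.piMap fun i => LinearMap.mulLeft ℝ (r i) from
      LinearMap.ext fun Y => funext fun i => by simp [coe_rhoLin, rho, bracket, along]]
    refine hasExp_piMap.2 fun i => ?_
    simpa using (hexp i).map (F := orderGE) (F' := orderGE) (LinearMap.mulRight ℝ (V i))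
      (fun N f hf => by simpa [mul_comm] using mul_mem_orderGE_of_right (V i) hf)
      (T' := LinearMap.mulLeft ℝ (r i)) fun f => by simp [mul_assoc]
  have hback := hmul.neg isCompleteFiltration_vecOrderGE (raises_rhoLin hr₁' (zero_mem _))
  rw [← rhoLin_neg, neg_zero] at hback
  exact (hasExp_expRho (neg_mem hr₁') (zero_mem _) _).unique isCompleteFiltration_vecOrderGE hback

lemma exists_expRho_expRho_eq (hφ : φ ∈ maps n) (hu : u ∈ fieldsSubmodule n)
    (hu₁ : u - 1 ∈ vecOrderGE 1) (h : ∀ i, along V (φ i) = u i * MvPowerSeries.subst φ (W i)) :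
    ∃ X ∈ fieldsOne n, ∃ r ∈ orbitalOne n, ∃ ψ ∈ maps n, AreInverse φ ψ ∧
      (∀ U, TurnsInto φ U (expRho 0 X U)) ∧ expRho r 0 (expRho 0 X V) = W := by
  obtain ⟨X, hX, ψ, hψ, hinv, hturns⟩ := exists_turnsInto_expRho hφ
  have hψs := hasSubst_of_mem_maps hψ
  let w : Fin n → Series n := fun i => MvPowerSeries.subst ψ (u i)
  have hw₁ : w - 1 ∈ vecOrderGE 1 := mem_piFiltration.2 fun i => by
    have := subst_mem_orderGE hψs (mem_orderGE_one_of_mem_maps hψ) (mem_piFiltration.1 hu₁ i)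
    rwa [Pi.sub_apply, Pi.one_apply, ← MvPowerSeries.coe_substAlgHom hψs, map_sub, map_one,
      MvPowerSeries.coe_substAlgHom hψs] at this
  obtain ⟨r, hr, hrw⟩ := exists_expRho_mul_eq (mem_fieldsSubmodule.2 fun i =>
    subst_mem_ringFrom hψ (mem_fieldsSubmodule.1 hu i)) hw₁
  have hwW : expRho 0 X V = w * W := funext fun i => by
    rw [← subst_subst_of_areInverse hφ hψ hinv (expRho 0 X V i), hturns V i, h i,
      MvPowerSeries.subst_mul hψs, subst_subst_of_areInverse hφ hψ hinv, Pi.mul_apply]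
  exact ⟨X, hX, r, hr, ψ, hψ, hinv, hturns, by rw [hwW, hrw]⟩

end TimeRescaling

section Normalization

variable {n N k : ℕ} {V : Fin n → Series n} {i : Fin n} {φ' φ ψ u v y : Series n} {a : ℝ}

lemma along_mem_orderGE_of_mem_one {f : Series n} (hV : V ∈ vecOrderGE 1) (hf : f ∈ orderGE N) :
    along V f ∈ orderGE N := by
  simpa only [add_tsub_cancel_left] using along_mem_orderGE hV hf

/-- The defect of `φ` and `u` in the equation `V(φ) = u (φ' + a φ²)`, which says that the
coordinate `φ` satisfies `φ̇ = φ' + a φ²` after the time of its component is rescaled by `u`. -/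
def residual (V : Fin n → Series n) (φ' : Series n) (a : ℝ) (φ u : Series n) : Series n :=
  along V φ - u * (φ' + MvPowerSeries.C a * φ ^ 2)

lemma residual_add (V : Fin n → Series n) (φ' : Series n) (a : ℝ) (φ u ψ v : Series n) :
    residual V φ' a (φ + ψ) (u + v) = residual V φ' a φ u +
      (along V ψ - v * (φ' + MvPowerSeries.C a * (φ + ψ) ^ 2)) -
        MvPowerSeries.C a * (u * (ψ * (φ + (φ + ψ)))) := by
  simp only [residual, ← alongLin_apply, map_add]
  ring

lemma residual_add_mem (hφ' : φ' - y ∈ orderGE 2) (hφ : φ ∈ orderGE 1) (hψ : ψ ∈ orderGE (k + 1))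
    (hv : v ∈ orderGE k) (h : residual V φ' a φ u + along V ψ - y * v ∈ orderGE (k + 2)) :
    residual V φ' a (φ + ψ) (u + v) ∈ orderGE (k + 2) := by
  have hφψ : φ + ψ ∈ orderGE 1 :=
    add_mem hφ (isCompleteFiltration_orderGE.anti (by lia) hψ)
  have hquad : v * (φ' - y + MvPowerSeries.C a * (φ + ψ) ^ 2) ∈ orderGE (k + 2) :=
    mul_mem_orderGE hv (add_mem hφ' (mul_mem_orderGE_of_right _ (pow_mem_orderGE hφψ 2)))
  have hcross : MvPowerSeries.C a * (u * (ψ * (φ + (φ + ψ)))) ∈ orderGE (k + 2) :=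
    mul_mem_orderGE_of_right _ (mul_mem_orderGE_of_right _
      (mul_mem_orderGE (M := k + 1) hψ (add_mem hφ hφψ)))
  convert sub_mem (sub_mem h hquad) hcross using 1
  rw [residual_add]
  ring

lemma X_pow_mem_orderGE (i : Fin n) (k : ℕ) : (MvPowerSeries.X i : Series n) ^ k ∈ orderGE k := by
  simpa using pow_mem_orderGE (X_mem_orderGE i) k

lemma mem_orderGE_one_of_sub_X_mem (hφ : φ - MvPowerSeries.X i ∈ orderGE 2) : φ ∈ orderGE 1 := by
  simpa using add_mem (isCompleteFiltration_orderGE.anti one_le_two hφ) (X_mem_orderGE i)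

lemma along_C_mul_X_pow_succ (V : Fin n → Series n) (i : Fin n) (c : ℝ) (k : ℕ) :
    along V (MvPowerSeries.C c * MvPowerSeries.X i ^ (k + 1)) =
      MvPowerSeries.C (c * (k + 1)) * MvPowerSeries.X i ^ k * V i := by
  change alongDer V _ = _
  rw [← MvPowerSeries.smul_eq_C_mul, Derivation.map_smul, Derivation.leibniz_pow,
    show alongDer V (MvPowerSeries.X i) = V i from along_X V i, ← Nat.cast_smul_eq_nsmul ℝ,
    smul_smul, MvPowerSeries.smul_eq_C_mul]
  simp [mul_assoc]

/-- With `v = c (k + 1) xᵢᵏ` the derivative of `c xᵢᵏ⁺¹` cancels `v φ'` to leading order, so the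
quadratic term of the equation becomes visible. -/
lemma residual_add_pow_sub_mem (hk : 1 ≤ k) (hφ : φ - MvPowerSeries.X i ∈ orderGE 2)
    (hu : u - 1 ∈ orderGE 1) (c : ℝ) :
    residual V φ' a (φ + MvPowerSeries.C c * MvPowerSeries.X i ^ (k + 1))
        (u + MvPowerSeries.C (c * (k + 1)) * MvPowerSeries.X i ^ k) -
      (residual V φ' a φ u + MvPowerSeries.C (c * (k + 1)) * (MvPowerSeries.X i ^ k *
          (V i - φ' - MvPowerSeries.C a * MvPowerSeries.X i ^ 2)) -
        MvPowerSeries.C (2 * a * c) * MvPowerSeries.X i ^ (k + 2)) ∈ orderGE (k + 3) := by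
  set x : Series n := MvPowerSeries.X i
  set ψ : Series n := MvPowerSeries.C c * x ^ (k + 1) with hψ_def
  have hψ : ψ ∈ orderGE (k + 1) := mul_mem_orderGE_of_right _ (X_pow_mem_orderGE i _)
  have hφψ : φ + ψ - x ∈ orderGE 2 := by
    rw [add_sub_right_comm]
    exact add_mem hφ (isCompleteFiltration_orderGE.anti (by lia) hψ)
  have hφψ₁ := mem_orderGE_one_of_sub_X_mem hφψ
  have hsquare : MvPowerSeries.C (a * (c * (k + 1))) * (x ^ k *
      ((φ + ψ - x) * (φ + ψ + x))) ∈ orderGE (k + 3) :=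
    mul_mem_orderGE_of_right _ (mul_mem_orderGE (X_pow_mem_orderGE i k)
      (mul_mem_orderGE hφψ (add_mem hφψ₁ (X_mem_orderGE i))))
  have hcross : MvPowerSeries.C a * (ψ *
      ((u - 1) * (φ + (φ + ψ)) + ((φ - x) + (φ + ψ - x)))) ∈ orderGE (k + 3) :=
    mul_mem_orderGE_of_right _ (mul_mem_orderGE (M := k + 1) (N := 2) hψ (add_mem
      (mul_mem_orderGE hu (add_mem (mem_orderGE_one_of_sub_X_mem hφ) hφψ₁)) (add_mem hφ hφψ)))
  convert neg_mem (add_mem hsquare hcross) using 1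
  rw [residual_add, hψ_def, along_C_mul_X_pow_succ]
  simp only [map_mul, map_ofNat]
  ring

lemma coeff_single_C_mul_X_pow (i : Fin n) (c : ℝ) (k : ℕ) :
    MvPowerSeries.coeff (Finsupp.single i k) (MvPowerSeries.C c * MvPowerSeries.X i ^ k) = c := by
  classical simp [MvPowerSeries.coeff_X_pow]

lemma coeff_single_X_pow_mul (i : Fin n) (k m : ℕ) (f : Series n) :
    MvPowerSeries.coeff (Finsupp.single i (k + m)) (MvPowerSeries.X i ^ k * f) =
      MvPowerSeries.coeff (Finsupp.single i m) f := by
  rw [MvPowerSeries.X_pow_eq, Finsupp.single_add, MvPowerSeries.coeff_add_monomial_mul, one_mul]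

lemma exists_coeff_residual_eq_zero (hk : 1 ≤ k) (hVi : V i - φ' ∈ orderGE 2)
    (hcoeff : MvPowerSeries.coeff (Finsupp.single i 2) (V i - φ') = a) (ha : a ≠ 0)
    (hφ : φ - MvPowerSeries.X i ∈ orderGE 2) (hu : u - 1 ∈ orderGE 1)
    (h : residual V φ' a φ u ∈ orderGE (k + 2)) :
    ∃ ψ ∈ ringFromSubalgebra i, ∃ v ∈ ringFromSubalgebra i, ψ ∈ orderGE (k + 1) ∧ v ∈ orderGE k ∧
      residual V φ' a (φ + ψ) (u + v) ∈ orderGE (k + 2) ∧ MvPowerSeries.coeff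
        (Finsupp.single i (k + 2)) (residual V φ' a (φ + ψ) (u + v)) = 0 := by
  let c := MvPowerSeries.coeff (Finsupp.single i (k + 2)) (residual V φ' a φ u) / (2 * a)
  let Z := V i - φ' - MvPowerSeries.C a * MvPowerSeries.X i ^ 2
  have hZ : Z ∈ orderGE 2 :=
    sub_mem hVi (mul_mem_orderGE_of_right _ (X_pow_mem_orderGE i 2))
  have hZcoeff : MvPowerSeries.coeff (Finsupp.single i 2) Z = 0 := by
    rw [map_sub, hcoeff, coeff_single_C_mul_X_pow, sub_self]
  have hXS : ∀ (b : ℝ) m, MvPowerSeries.C b * MvPowerSeries.X i ^ m ∈ ringFromSubalgebra i :=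
    fun b m => mul_mem ((ringFromSubalgebra i).algebraMap_mem b) (pow_mem (X_mem_ringFrom i) m)
  have hsub := residual_add_pow_sub_mem (V := V) (φ' := φ') (a := a) hk hφ hu c
  refine ⟨_, hXS c (k + 1), _, hXS (c * (k + 1)) k,
    mul_mem_orderGE_of_right _ (X_pow_mem_orderGE i _),
    mul_mem_orderGE_of_right _ (X_pow_mem_orderGE i _), ?_, ?_⟩
  · refine (Submodule.sub_mem_iff_left _ ?_).1 (isCompleteFiltration_orderGE.anti (by lia) hsub)
    exact sub_mem
      (add_mem h (mul_mem_orderGE_of_right _ (mul_mem_orderGE (X_pow_mem_orderGE i k) hZ)))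
      (mul_mem_orderGE_of_right _ (X_pow_mem_orderGE i _))
  · have hR₀ := mem_orderGE_iff_coeff.1 hsub (Finsupp.single i (k + 2)) (by simp)
    rw [map_sub, map_sub, map_add, MvPowerSeries.coeff_C_mul, coeff_single_X_pow_mul, hZcoeff,
      coeff_single_C_mul_X_pow] at hR₀
    have hc : 2 * a * c =
        MvPowerSeries.coeff (Finsupp.single i (k + 2)) (residual V φ' a φ u) :=
      mul_div_cancel₀ _ (mul_ne_zero two_ne_zero ha)
    linarith

/-- The linearized equation `Q + V(ψ) = y v` can be solved to leading order for all
`Q ∈ ℝ[[xᵢ, …, xₙ]]` whose lowest order part does not contain a power of `xᵢ`. -/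
def IsSolvableAlong (V : Fin n → Series n) (i : Fin n) (y : Series n) : Prop :=
  ∀ k, ∀ Q ∈ ringFromSubalgebra i, Q ∈ orderGE (k + 1) →
    MvPowerSeries.coeff (Finsupp.single i (k + 1)) Q = 0 →
    ∃ ψ ∈ ringFromSubalgebra i, ∃ v ∈ ringFromSubalgebra i, ψ ∈ orderGE (k + 1) ∧ v ∈ orderGE k ∧
      Q + along V ψ - y * v ∈ orderGE (k + 2)

/-- The pair `p = (φ, u)` solves `V(φ) = u (φ' + a φ²)` up to order `N + 2`, and its defect has no
term `xᵢᴺ⁺²`, the one obstruction to solving the linearized equation in the next order. -/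
structure IsApproxSolution (V : Fin n → Series n) (i : Fin n) (φ' : Series n) (a : ℝ) (N : ℕ)
    (p : Series n × Series n) : Prop where
  fst_mem : p.1 ∈ ringFromSubalgebra i
  snd_mem : p.2 ∈ ringFromSubalgebra i
  fst_sub_X_mem : p.1 - MvPowerSeries.X i ∈ orderGE 2
  snd_sub_one_mem : p.2 - 1 ∈ orderGE 1
  residual_mem : residual V φ' a p.1 p.2 ∈ orderGE (N + 2)
  coeff_residual :
    MvPowerSeries.coeff (Finsupp.single i (N + 2)) (residual V φ' a p.1 p.2) = 0

lemma isApproxSolution_zero (hVi : V i - φ' ∈ orderGE 2)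
    (hcoeff : MvPowerSeries.coeff (Finsupp.single i 2) (V i - φ') = a) :
    IsApproxSolution V i φ' a 0 (MvPowerSeries.X i, 1) := by
  have hres : residual V φ' a (MvPowerSeries.X i) 1 =
      V i - φ' - MvPowerSeries.C a * MvPowerSeries.X i ^ 2 := by
    rw [residual, along_X]
    ring
  refine ⟨X_mem_ringFrom i, one_mem _, by simp, by simp, ?_, ?_⟩
  · rw [hres]
    exact sub_mem hVi (mul_mem_orderGE_of_right _ (X_pow_mem_orderGE i 2))
  · rw [hres, map_sub, hcoeff, coeff_single_C_mul_X_pow, sub_self]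

lemma residual_mem_ringFrom (hV : V ∈ fieldsSubmodule n) (hφ' : φ' ∈ ringFromSubalgebra i)
    (a : ℝ) (hφ : φ ∈ ringFromSubalgebra i) (hu : u ∈ ringFromSubalgebra i) :
    residual V φ' a φ u ∈ ringFromSubalgebra i :=
  sub_mem (along_mem_ringFrom hV hφ) (mul_mem hu (add_mem hφ'
    (mul_mem ((ringFromSubalgebra i).algebraMap_mem a) (pow_mem hφ 2))))

lemma IsApproxSolution.exists_succ {p : Series n × Series n} (hV : V ∈ fieldsSubmodule n)
    (hφ'S : φ' ∈ ringFromSubalgebra i) (hφ' : φ' - y ∈ orderGE 2) (hVi : V i - φ' ∈ orderGE 2)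
    (hcoeff : MvPowerSeries.coeff (Finsupp.single i 2) (V i - φ') = a) (ha : a ≠ 0)
    (hy : IsSolvableAlong V i y) (hp : IsApproxSolution V i φ' a N p) :
    ∃ q, IsApproxSolution V i φ' a (N + 1) q ∧
      q - p ∈ (orderGE N).prod (orderGE N : Submodule ℝ (Series n)) := by
  obtain ⟨φ, u⟩ := p
  obtain ⟨hφS, huS, hφ, hu, hres, hres₀⟩ := hp
  obtain ⟨ψ, hψS, v, hvS, hψ, hv, hQ⟩ :=
    hy (N + 1) _ (residual_mem_ringFrom hV hφ'S a hφS huS) hres hres₀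
  have hφψ : φ + ψ - MvPowerSeries.X i ∈ orderGE 2 := by
    rw [add_sub_right_comm]
    exact add_mem hφ (isCompleteFiltration_orderGE.anti (by lia) hψ)
  have huv : u + v - 1 ∈ orderGE 1 := by
    rw [add_sub_right_comm]
    exact add_mem hu (isCompleteFiltration_orderGE.anti (by lia) hv)
  obtain ⟨χ, hχS, w, hwS, hχ, hw, hR, hR₀⟩ := exists_coeff_residual_eq_zero (by lia) hVi hcoeff ha
    hφψ huv (residual_add_mem hφ' (mem_orderGE_one_of_sub_X_mem hφ) hψ hv hQ)
  refine ⟨(φ + ψ + χ, u + v + w), ⟨add_mem (add_mem hφS hψS) hχS, add_mem (add_mem huS hvS) hwS,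
    ?_, ?_, hR, hR₀⟩, ?_, ?_⟩
  · rw [add_sub_right_comm]
    exact add_mem hφψ (isCompleteFiltration_orderGE.anti (by lia) hχ)
  · rw [add_sub_right_comm]
    exact add_mem huv (isCompleteFiltration_orderGE.anti (by lia) hw)
  · rw [Prod.fst_sub, add_assoc, add_sub_cancel_left]
    exact isCompleteFiltration_orderGE.anti (by lia) (add_mem hψ hχ)
  · rw [Prod.snd_sub, add_assoc u, add_sub_cancel_left]
    exact isCompleteFiltration_orderGE.anti (by lia) (add_mem hv hw)

lemma residual_sub_residual_mem (hV : V ∈ vecOrderGE 1) (hψ : ψ ∈ orderGE N) (hv : v ∈ orderGE N)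
    (φ' : Series n) (a : ℝ) (φ u : Series n) :
    residual V φ' a (φ + ψ) (u + v) - residual V φ' a φ u ∈ orderGE N := by
  rw [residual_add, add_sub_assoc, add_sub_cancel_left, mul_comm v, mul_comm ψ]
  exact sub_mem (sub_mem (along_mem_orderGE_of_mem_one hV hψ) (mul_mem_orderGE_of_right _ hv))
    (mul_mem_orderGE_of_right _ (mul_mem_orderGE_of_right _ (mul_mem_orderGE_of_right _ hψ)))

lemma exists_along_eq_mul (hV : V ∈ fieldsSubmodule n) (hV₁ : V ∈ vecOrderGE 1)
    (hφ'S : φ' ∈ ringFromSubalgebra i) (hφ' : φ' - y ∈ orderGE 2) (hVi : V i - φ' ∈ orderGE 2)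
    (hcoeff : MvPowerSeries.coeff (Finsupp.single i 2) (V i - φ') = a) (ha : a ≠ 0)
    (hy : IsSolvableAlong V i y) :
    ∃ φ ∈ ringFromSubalgebra i, ∃ u ∈ ringFromSubalgebra i, φ - MvPowerSeries.X i ∈ orderGE 2 ∧
      u - 1 ∈ orderGE 1 ∧ along V φ = u * (φ' + MvPowerSeries.C a * φ ^ 2) := by
  have hF := isCompleteFiltration_orderGE (σ := Fin n) (R := ℝ)
  obtain ⟨⟨φ, u⟩, hlim⟩ := (hF.prod hF).exists_limit (isApproxSolution_zero hVi hcoeff)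
    fun N p hp => hp.exists_succ hV hφ'S hφ' hVi hcoeff ha hy
  choose p hp hsub using hlim
  refine ⟨φ, isClosedFor_ringFromSubalgebra i φ fun N => ⟨_, (hp N).fst_mem, (hsub N).1⟩,
    u, isClosedFor_ringFromSubalgebra i u fun N => ⟨_, (hp N).snd_mem, (hsub N).2⟩,
    by simpa using add_mem (hsub 2).1 (hp 2).fst_sub_X_mem,
    by simpa using add_mem (hsub 1).2 (hp 1).snd_sub_one_mem,
    hF.eq_of_sub_mem fun N => ?_⟩
  have hres := residual_sub_residual_mem hV₁ (hsub N).1 (hsub N).2 φ' a (p N).1 (p N).2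
  simpa [residual] using add_mem hres (hF.anti (by lia) (hp N).residual_mem)

end Normalization

section DivX

variable {σ R : Type*} [CommRing R] {f : MvPowerSeries σ R} {i j : σ} {N : ℕ}

/-- The quotient of `f` by the variable `xⱼ`, dropping the terms not divisible by `xⱼ`. -/
def divX (j : σ) (f : MvPowerSeries σ R) : MvPowerSeries σ R :=
  fun d => MvPowerSeries.coeff (d + Finsupp.single j 1) f

lemma coeff_divX (j : σ) (f : MvPowerSeries σ R) (d : σ →₀ ℕ) :
    MvPowerSeries.coeff d (divX j f) = MvPowerSeries.coeff (d + Finsupp.single j 1) f := rfl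

lemma coeff_sub_X_mul_divX (j : σ) (f : MvPowerSeries σ R) (d : σ →₀ ℕ) :
    MvPowerSeries.coeff d (f - MvPowerSeries.X j * divX j f) =
      if d j = 0 then MvPowerSeries.coeff d f else 0 := by
  classical
  rw [map_sub, MvPowerSeries.X, MvPowerSeries.coeff_monomial_mul, one_mul, coeff_divX]
  by_cases hd : d j = 0
  · simp [hd]
  · have hle : Finsupp.single j 1 ≤ d := Finsupp.single_le_iff.2 (Nat.one_le_iff_ne_zero.2 hd)
    rw [if_pos hle, if_neg hd, tsub_add_cancel_of_le hle, sub_self]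

lemma divX_mem_orderGE (hf : f ∈ orderGE (N + 1)) : divX j f ∈ orderGE N :=
  mem_orderGE_iff_coeff.2 fun d hd => mem_orderGE_iff_coeff.1 hf _ (by simpa using hd)

lemma eq_single_degree {d : σ →₀ ℕ} (h : ∀ j ≠ i, d j = 0) : d = Finsupp.single i d.degree := by
  obtain ⟨m, rfl⟩ : ∃ m, d = Finsupp.single i m :=
    ⟨d i, Finsupp.ext fun j => by
      obtain rfl | hj := eq_or_ne j i
      · simp
      · rw [h j hj, Finsupp.single_eq_of_ne hj]⟩
  rw [Finsupp.degree_single]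

end DivX

section LinearizedEquation

variable {n N : ℕ} {V : Fin n → Series n} {i j : Fin n}

lemma divX_mem_ringFrom {f : Series n} (hf : f ∈ ringFromSubalgebra i) :
    divX j f ∈ ringFromSubalgebra i := fun _ hd k hk =>
  (Nat.eq_zero_of_add_eq_zero (hf _ hd k hk)).1

lemma exists_coeff_sub_sum_X_mul (T : Finset (Fin n)) {Q : Series n}
    (hQS : Q ∈ ringFromSubalgebra i) (hQ : Q ∈ orderGE (N + 1)) :
    ∃ B : Fin n → Series n, (∀ j, B j ∈ ringFromSubalgebra i ∧ B j ∈ orderGE N) ∧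
      ∀ d, MvPowerSeries.coeff d (Q - ∑ j ∈ T, MvPowerSeries.X j * B j) =
        if ∀ j ∈ T, d j = 0 then MvPowerSeries.coeff d Q else 0 := by
  classical
  induction T using Finset.induction with
  | empty => exact ⟨0, fun j => ⟨zero_mem _, zero_mem _⟩, by simp⟩
  | insert k T hk ih =>
    obtain ⟨B, hB, hcoeff⟩ := ih
    let Q' := Q - ∑ j ∈ T, MvPowerSeries.X j * B j
    have hQ'S : Q' ∈ ringFromSubalgebra i := fun d hd =>
      hQS d fun hQd => hd (by simp [Q', hcoeff, hQd])
    have hQ' : Q' ∈ orderGE (N + 1) := mem_orderGE_iff_coeff.2 fun d hd => by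
      simp [Q', hcoeff, mem_orderGE_iff_coeff.1 hQ d hd]
    refine ⟨Function.update B k (divX k Q'), fun j => ?_, fun _ => ?_⟩
    · obtain rfl | hj := eq_or_ne j k
      · simpa using ⟨divX_mem_ringFrom hQ'S, divX_mem_orderGE hQ'⟩
      · simpa [hj] using hB j
    · rw [sum_insert hk, sum_congr rfl fun j hj => by
        rw [Function.update_of_ne (ne_of_mem_of_not_mem hj hk)], Function.update_self,
        add_comm, ← sub_sub, coeff_sub_X_mul_divX, hcoeff]
      simp [ite_and]

lemma exists_sub_sum_X_mul_mem {Q : Series n} (hQS : Q ∈ ringFromSubalgebra i)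
    (hQ : Q ∈ orderGE (N + 1)) (hQ₀ : MvPowerSeries.coeff (Finsupp.single i (N + 1)) Q = 0) :
    ∃ B : Fin n → Series n, (∀ j, B j ∈ ringFromSubalgebra i ∧ B j ∈ orderGE N) ∧
      Q - ∑ j ∈ Ioi i, MvPowerSeries.X j * B j ∈ orderGE (N + 2) := by
  obtain ⟨B, hB, hcoeff⟩ := exists_coeff_sub_sum_X_mul (Ioi i) hQS hQ
  refine ⟨B, hB, mem_orderGE_iff_coeff.2 fun d hd => ?_⟩
  rw [hcoeff, ite_eq_right_iff]
  intro hlater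
  by_contra hQd
  have hd_single : d = Finsupp.single i d.degree := eq_single_degree fun j hj =>
    (lt_or_gt_of_ne hj).elim (hQS d hQd j) fun h => hlater j (mem_Ioi.2 h)
  have hd_degree : d.degree = N + 1 := by
    by_contra h
    exact hQd (mem_orderGE_iff_coeff.1 hQ d (by lia))
  exact hQd (by rwa [hd_single, hd_degree])

lemma isSolvableAlong_two (V : Fin 3 → Series 3) : IsSolvableAlong V 2 0 :=
  fun k Q hQS hQ hQ₀ => by
    obtain ⟨B, -, hQB⟩ := exists_sub_sum_X_mul_mem hQS hQ hQ₀
    refine ⟨0, zero_mem _, 0, zero_mem _, zero_mem _, zero_mem _, ?_⟩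
    rw [show Ioi (2 : Fin 3) = ∅ by decide, sum_empty, sub_zero] at hQB
    rwa [← alongLin_apply, map_zero, add_zero, mul_zero, sub_zero]

lemma isSolvableAlong_one (V : Fin 3 → Series 3) : IsSolvableAlong V 1 (MvPowerSeries.X 2) :=
  fun k Q hQS hQ hQ₀ => by
    obtain ⟨B, hB, hQB⟩ := exists_sub_sum_X_mul_mem hQS hQ hQ₀
    refine ⟨0, zero_mem _, B 2, (hB 2).1, zero_mem _, (hB 2).2, ?_⟩
    rw [show Ioi (1 : Fin 3) = {2} by decide, sum_singleton] at hQB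
    rwa [← alongLin_apply, map_zero, add_zero]

lemma isSolvableAlong_zero {V : Fin 3 → Series 3} (hV : V ∈ fieldsSubmodule 3)
    (hV₁ : V ∈ vecOrderGE 1) (hV1 : V 1 - MvPowerSeries.X 2 ∈ orderGE 2) :
    IsSolvableAlong V 0 (MvPowerSeries.X 1) := fun k Q hQS hQ hQ₀ => by
  obtain ⟨B, hB, hQB⟩ := exists_sub_sum_X_mul_mem hQS hQ hQ₀
  have hX1 : MvPowerSeries.X 1 ∈ ringFromSubalgebra (0 : Fin 3) :=
    ringFromSubalgebra_anti (Fin.zero_le 1) (X_mem_ringFrom 1)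
  refine ⟨-(MvPowerSeries.X 1 * B 2), neg_mem (mul_mem hX1 (hB 2).1), B 1 - along V (B 2),
    sub_mem (hB 1).1 (along_mem_ringFrom hV (hB 2).1),
    neg_mem (by simpa [add_comm] using mul_mem_orderGE (X_mem_orderGE 1) (hB 2).2),
    sub_mem (hB 1).2 (along_mem_orderGE_of_mem_one hV₁ (hB 2).2), ?_⟩
  convert sub_mem hQB (mul_mem_orderGE (hB 2).2 hV1) using 1
  rw [show Ioi (0 : Fin 3) = {1, 2} by decide, sum_pair (by decide), ← alongLin_apply, map_neg,
    alongLin_apply, along_mul, along_X]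
  ring

end LinearizedEquation

section NormalForm

lemma coeff_single_of_mem_ringFrom {n : ℕ} {i j : Fin n} (hij : i < j) {k : ℕ} (hk : k ≠ 0)
    {f : Series n} (hf : f ∈ ringFromSubalgebra j) :
    MvPowerSeries.coeff (Finsupp.single i k) f = 0 := by
  by_contra h
  exact hk (by simpa using hf _ h i hij)

lemma subst_normalForm {φ : Fin 3 → Series 3} (hφ : MvPowerSeries.HasSubst φ) (a b c : ℝ) :
    (fun i => MvPowerSeries.subst φ (normalForm a b c i)) =
      ![φ 1 + MvPowerSeries.C a * φ 0 ^ 2, φ 2 + MvPowerSeries.C b * φ 1 ^ 2,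
        MvPowerSeries.C c * φ 2 ^ 2] := by
  have hterm : ∀ (t : ℝ) (i : Fin 3), MvPowerSeries.subst φ
      (MvPowerSeries.C t * (MvPowerSeries.X i : Series 3) ^ 2) = MvPowerSeries.C t * φ i ^ 2 :=
    fun t i => by
      rw [← MvPowerSeries.smul_eq_C_mul, MvPowerSeries.subst_smul hφ,
        MvPowerSeries.subst_pow hφ, MvPowerSeries.subst_X hφ, MvPowerSeries.smul_eq_C_mul]
  funext i
  fin_cases i <;>
    simp [normalForm, system, MvPowerSeries.subst_add hφ, MvPowerSeries.subst_X hφ, hterm]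

lemma exists_along_eq_mul_of_lt {n : ℕ} {V : Fin n → Series n} {i j : Fin n} {φ' : Series n}
    {a : ℝ} (hij : i < j) (hV : V ∈ fieldsSubmodule n) (hV₁ : V ∈ vecOrderGE 1)
    (hφ'S : φ' ∈ ringFromSubalgebra j) (hφ' : φ' - MvPowerSeries.X j ∈ orderGE 2)
    (hVi : V i - MvPowerSeries.X j ∈ orderGE 2)
    (hcoeff : MvPowerSeries.coeff (Finsupp.single i 2) (V i) = a) (ha : a ≠ 0)
    (hy : IsSolvableAlong V i (MvPowerSeries.X j)) :
    ∃ φ ∈ ringFromSubalgebra i, ∃ u ∈ ringFromSubalgebra i, φ - MvPowerSeries.X i ∈ orderGE 2 ∧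
      u - 1 ∈ orderGE 1 ∧ along V φ = u * (φ' + MvPowerSeries.C a * φ ^ 2) :=
  exists_along_eq_mul hV hV₁ (ringFromSubalgebra_anti hij.le hφ'S) hφ'
    (by simpa using sub_mem hVi hφ')
    (by rw [map_sub, hcoeff, coeff_single_of_mem_ringFrom hij two_ne_zero hφ'S, sub_zero]) ha hy

lemma sub_system_mem_vecOrderGE {V : Fin 3 → Series 3} {N : ℕ} :
    V - system 0 0 0 ∈ vecOrderGE N ↔ V 0 - MvPowerSeries.X 1 ∈ orderGE N ∧
      V 1 - MvPowerSeries.X 2 ∈ orderGE N ∧ V 2 ∈ orderGE N := by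
  rw [mem_piFiltration, Fin.forall_fin_succ, Fin.forall_fin_two]
  simp only [Pi.sub_apply]
  simp [system]

lemma mem_vecOrderGE_one_of_sub_system_mem {V : Fin 3 → Series 3}
    (hV : V - system 0 0 0 ∈ vecOrderGE 2) : V ∈ vecOrderGE 1 := by
  rw [sub_system_mem_vecOrderGE] at hV
  exact mem_piFiltration.2 <| Fin.forall_fin_succ.2 ⟨mem_orderGE_one_of_sub_X_mem hV.1,
    Fin.forall_fin_two.2 ⟨mem_orderGE_one_of_sub_X_mem hV.2.1,
      isCompleteFiltration_orderGE.anti one_le_two hV.2.2⟩⟩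

/-- The equations are solved from the last component upwards, as `φᵢ₊₁` enters the equation for
`φᵢ`. -/
lemma exists_maps_along_eq_mul {V : Fin 3 → Series 3} (hV : V ∈ fieldsSubmodule 3)
    (hlin : V - system 0 0 0 ∈ vecOrderGE 2) {a b c : ℝ}
    (ha : MvPowerSeries.coeff (Finsupp.single 0 2) (V 0) = a)
    (hb : MvPowerSeries.coeff (Finsupp.single 1 2) (V 1) = b)
    (hc : MvPowerSeries.coeff (Finsupp.single 2 2) (V 2) = c)
    (ha_ne : a ≠ 0) (hb_ne : b ≠ 0) (hc_ne : c ≠ 0) :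
    ∃ φ ∈ maps 3, ∃ u ∈ fieldsSubmodule 3, u - 1 ∈ vecOrderGE 1 ∧
      ∀ i, along V (φ i) = u i * MvPowerSeries.subst φ (normalForm a b c i) := by
  have hV₁ := mem_vecOrderGE_one_of_sub_system_mem hlin
  rw [sub_system_mem_vecOrderGE] at hlin
  obtain ⟨hV0, hV1, hV2⟩ := hlin
  obtain ⟨φ₃, hφ₃S, u₃, hu₃S, hφ₃, hu₃, h₃⟩ := exists_along_eq_mul hV hV₁ (zero_mem _) (by simp)
    (by simpa using hV2) (by simpa using hc) hc_ne (isSolvableAlong_two V)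
  obtain ⟨φ₂, hφ₂S, u₂, hu₂S, hφ₂, hu₂, h₂⟩ := exists_along_eq_mul_of_lt (by decide) hV hV₁ hφ₃S
    hφ₃ hV1 hb hb_ne (isSolvableAlong_one V)
  obtain ⟨φ₁, hφ₁S, u₁, hu₁S, hφ₁, hu₁, h₁⟩ := exists_along_eq_mul_of_lt (by decide) hV hV₁ hφ₂S
    hφ₂ hV0 ha ha_ne (isSolvableAlong_zero hV hV₁ hV1)
  have hφ : ![φ₁, φ₂, φ₃] ∈ maps 3 := Fin.forall_fin_succ.2 ⟨⟨hφ₁S, hφ₁⟩,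
    Fin.forall_fin_two.2 ⟨⟨hφ₂S, hφ₂⟩, ⟨hφ₃S, hφ₃⟩⟩⟩
  refine ⟨_, hφ, ![u₁, u₂, u₃],
    mem_fieldsSubmodule.2 (Fin.forall_fin_succ.2 ⟨hu₁S, Fin.forall_fin_two.2 ⟨hu₂S, hu₃S⟩⟩),
    mem_piFiltration.2 (Fin.forall_fin_succ.2 ⟨hu₁, Fin.forall_fin_two.2 ⟨hu₂, hu₃⟩⟩), fun i => ?_⟩
  rw [congr_fun (subst_normalForm (hasSubst_of_mem_maps hφ) a b c) i]
  fin_cases i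
  · exact h₁
  · exact h₂
  · simpa using h₃

end NormalForm

section AxisOrder

variable {σ R : Type*} [CommRing R] {i : σ} {M N : ℕ} {f g : MvPowerSeries σ R}

/-- Power series whose restriction to the `xᵢ`-axis has order at least `m`. -/
def axisOrderGE (i : σ) (m : ℕ) : Submodule R (MvPowerSeries σ R) where
  carrier := {f | ∀ k < m, MvPowerSeries.coeff (Finsupp.single i k) f = 0}
  add_mem' hf hg k hk := by rw [map_add, hf k hk, hg k hk, add_zero]
  zero_mem' _ _ := map_zero _
  smul_mem' c f hf k hk := by rw [map_smul, hf k hk, smul_zero]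

lemma axisOrderGE_anti (i : σ) :
    Antitone (axisOrderGE i : ℕ → Submodule R (MvPowerSeries σ R)) :=
  fun _ _ h _ hf k hk => hf k (hk.trans_le h)

lemma orderGE_le_axisOrderGE (i : σ) (m : ℕ) :
    orderGE m ≤ (axisOrderGE i m : Submodule R (MvPowerSeries σ R)) :=
  fun _ hf _ hk => mem_orderGE_iff_coeff.1 hf _ (by simpa using hk)

lemma mul_mem_axisOrderGE (hf : f ∈ axisOrderGE i M) (hg : g ∈ axisOrderGE i N) :
    f * g ∈ axisOrderGE i (M + N) := fun k hk => by
  classical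
  rw [MvPowerSeries.coeff_mul, Finsupp.antidiagonal_single, sum_map]
  refine sum_eq_zero fun p hp => ?_
  have hp := HasAntidiagonal.mem_antidiagonal.1 hp
  rcases lt_or_ge p.1 M with h | h
  · exact mul_eq_zero_of_left (hf _ h) _
  · exact mul_eq_zero_of_right _ (hg _ (by lia))

lemma pderiv_mem_axisOrderGE (hf : f ∈ axisOrderGE i N) :
    MvPowerSeries.pderiv R i f ∈ axisOrderGE i (N - 1) := fun k hk => by
  rw [MvPowerSeries.coeff_pderiv, ← Finsupp.single_add, hf _ (by lia), zero_mul]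

lemma mul_mem_axisOrderGE_of_left (hf : f ∈ axisOrderGE i N) (g : MvPowerSeries σ R) :
    f * g ∈ axisOrderGE i N :=
  mul_mem_axisOrderGE (N := 0) hf fun _ hk => absurd hk (Nat.not_lt_zero _)

end AxisOrder

section Invariance

variable {n m M N : ℕ} {i j : Fin n} {f : Series n} {r X V V' : Fin n → Series n}

lemma mem_axisOrderGE_of_lt (hij : i < j) (hfS : f ∈ ringFromSubalgebra j) (hf : f ∈ orderGE 1)
    (m : ℕ) : f ∈ axisOrderGE i m := fun k _ => by
  obtain rfl | hk := eq_or_ne k 0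
  · simpa using mem_orderGE_one.1 hf
  · exact coeff_single_of_mem_ringFrom hij hk hfS

lemma along_mem_axisOrderGE (hV : V ∈ fieldsSubmodule n) (hV₁ : V ∈ vecOrderGE 1)
    (hVi : V i ∈ axisOrderGE i M) (hfS : f ∈ ringFromSubalgebra i) (hf : f ∈ axisOrderGE i N) :
    along V f ∈ axisOrderGE i (M + (N - 1)) :=
  (axisOrderGE i _).sum_mem fun j _ => by
    rcases lt_trichotomy j i with hji | rfl | hij
    · rw [pderiv_eq_zero_of_lt hfS hji, mul_zero]
      exact zero_mem _
    · exact mul_mem_axisOrderGE hVi (pderiv_mem_axisOrderGE hf)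
    · exact mul_mem_axisOrderGE_of_left (mem_axisOrderGE_of_lt hij (mem_fieldsSubmodule.1 hV j)
        (mem_piFiltration.1 hV₁ j) _) _

/-- Feed-forward vector fields vanishing at the origin whose `i`-th component has order at least
`m` along the `xᵢ`-axis, for every `i`. -/
def axisFields (n m : ℕ) : Submodule ℝ (Fin n → Series n) :=
  fieldsSubmodule n ⊓ vecOrderGE 1 ⊓ piFiltration axisOrderGE m

lemma isClosedFor_axisFields : IsClosedFor vecOrderGE (axisFields n m) :=
  (isClosedFor_fieldsSubmodule.inf (isClosedFor_self _ 1)).inf <| isClosedFor_of_le (N := m)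
    fun _ hV => mem_piFiltration.2 fun i => orderGE_le_axisOrderGE i m (mem_piFiltration.1 hV i)

lemma axisFields_anti : Antitone (axisFields n) := fun _ _ h _ hV =>
  ⟨hV.1, mem_piFiltration.2 fun i => axisOrderGE_anti i h (mem_piFiltration.1 hV.2 i)⟩

lemma rhoLin_mem_axisFields (hr : r ∈ orbitalOne n) (hX : X ∈ fieldsOne n)
    (hV : V ∈ axisFields n m) : rhoLin r X V ∈ axisFields n (m + 1) := by
  obtain ⟨hrS, hr₁⟩ := mem_orbitalOne.1 hr
  obtain ⟨hXS, hX₂⟩ := mem_fieldsOne.1 hX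
  obtain ⟨⟨hVS, hV₁⟩, hVm⟩ := hV
  have hanti := (isCompleteFiltration_vecOrderGE (n := n)).anti one_le_two
  refine ⟨⟨rhoLin_mem_fieldsSubmodule hrS hXS hVS, hanti (raises_rhoLin hr₁ hX₂ 1 V hV₁)⟩,
    mem_piFiltration.2 fun i => ?_⟩
  have hri := orderGE_le_axisOrderGE i 1 (mem_piFiltration.1 hr₁ i)
  have hXi := orderGE_le_axisOrderGE i 2 (mem_piFiltration.1 hX₂ i)
  have hVi := mem_piFiltration.1 hVm i
  refine add_mem ?_ (sub_mem (axisOrderGE_anti i (by lia) (along_mem_axisOrderGE hXS (hanti hX₂)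
    hXi (mem_fieldsSubmodule.1 hVS i) hVi)) ?_)
  · rw [add_comm m]
    exact mul_mem_axisOrderGE hri hVi
  · exact along_mem_axisOrderGE hVS hV₁ hVi (mem_fieldsSubmodule.1 hXS i) hXi

lemma expRho_sub_mem_axisFields (hr : r ∈ orbitalOne n) (hX : X ∈ fieldsOne n)
    (hV : V ∈ axisFields n m) : expRho r X V - V ∈ axisFields n (m + 1) :=
  (hasExp_expRho (mem_orbitalOne.1 hr).2 (mem_fieldsOne.1 hX).2 V).sub_mem
    isCompleteFiltration_vecOrderGE isClosedFor_axisFields (rhoLin_mem_axisFields hr hX hV)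
    fun _ hY => axisFields_anti (Nat.le_succ _) (rhoLin_mem_axisFields hr hX hY)

lemma sub_mem_axisFields_of_reflTransGen (hV : V ∈ axisFields n m)
    (h : Relation.ReflTransGen OuterStep V V') : V' - V ∈ axisFields n (m + 1) := by
  induction h with
  | refl => simp
  | tail _ hstep ih =>
    obtain ⟨r, hr, X, hX, rfl⟩ := hstep
    have hU := add_mem (axisFields_anti (Nat.le_succ m) ih) hV
    rw [sub_add_cancel] at hU
    simpa using add_mem (expRho_sub_mem_axisFields hr hX hU) ih

lemma coeff_single_eq_of_reflTransGen (hV : V ∈ axisFields n m)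
    (h : Relation.ReflTransGen OuterStep V V') (i : Fin n) :
    MvPowerSeries.coeff (Finsupp.single i m) (V' i) =
      MvPowerSeries.coeff (Finsupp.single i m) (V i) := by
  have hi := mem_piFiltration.1 (sub_mem_axisFields_of_reflTransGen hV h).2 i m m.lt_succ_self
  rwa [Pi.sub_apply, map_sub, sub_eq_zero] at hi

end Invariance

section System

variable {F₁ F₂ F₃ : Series 3}

lemma system_mem_fieldsSubmodule (hF₂ : F₂ ∈ ringFrom 1) (hF₃ : F₃ ∈ ringFrom 2) :
    system F₁ F₂ F₃ ∈ fieldsSubmodule 3 :=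
  mem_fieldsSubmodule.2 <| Fin.forall_fin_succ.2 ⟨fun _ _ j hj => absurd hj (Fin.not_lt_zero j),
    Fin.forall_fin_two.2 ⟨add_mem (S := Subalgebra ℝ (Series 3))
      (ringFromSubalgebra_anti (by decide) (X_mem_ringFrom 2)) hF₂, hF₃⟩⟩

lemma system_sub_system_mem_vecOrderGE (h₁ : 2 ≤ F₁.order) (h₂ : 2 ≤ F₂.order)
    (h₃ : 2 ≤ F₃.order) : system F₁ F₂ F₃ - system 0 0 0 ∈ vecOrderGE 2 := by
  rw [sub_system_mem_vecOrderGE]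
  refine ⟨?_, ?_, mem_orderGE_iff_order.2 h₃⟩
  · simpa [system] using mem_orderGE_iff_order.2 h₁
  · simpa [system] using mem_orderGE_iff_order.2 h₂

lemma coeff_single_system (i : Fin 3) :
    MvPowerSeries.coeff (Finsupp.single i 2) (system F₁ F₂ F₃ i) =
      MvPowerSeries.coeff (Finsupp.single i 2) (![F₁, F₂, F₃] i) := by
  have hX : ∀ i j : Fin 3,
      MvPowerSeries.coeff (Finsupp.single i 2) (MvPowerSeries.X j : Series 3) = 0 :=
    fun i j => by
      classical
      rw [MvPowerSeries.coeff_X, if_neg fun h => by simpa using congrArg Finsupp.degree h]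
  fin_cases i <;> simp [system, hX]

lemma mem_axisFields_two {V : Fin 3 → Series 3} (hV : V ∈ fieldsSubmodule 3)
    (hlin : V - system 0 0 0 ∈ vecOrderGE 2) : V ∈ axisFields 3 2 := by
  refine ⟨⟨hV, mem_vecOrderGE_one_of_sub_system_mem hlin⟩, mem_piFiltration.2 ?_⟩
  obtain ⟨h0, h1, h2⟩ := sub_system_mem_vecOrderGE.1 hlin
  have hX : ∀ {i j : Fin 3}, i < j → (MvPowerSeries.X j : Series 3) ∈ axisOrderGE i 2 :=
    fun hij => mem_axisOrderGE_of_lt hij (X_mem_ringFrom _) (X_mem_orderGE _) 2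
  refine Fin.forall_fin_succ.2 ⟨?_, Fin.forall_fin_two.2 ⟨?_, orderGE_le_axisOrderGE 2 2 h2⟩⟩
  · simpa using add_mem (orderGE_le_axisOrderGE 0 2 h0) (hX (by decide : (0 : Fin 3) < 1))
  · simpa using add_mem (orderGE_le_axisOrderGE 1 2 h1) (hX (by decide : (1 : Fin 3) < 2))

end System

end FeedForward

end

theorem mainTheorem1
    (F₁ F₂ F₃ : FeedForward.Series 3)
    (hF₂ : F₂ ∈ FeedForward.ringFrom (1 : Fin 3))
    (hF₃ : F₃ ∈ FeedForward.ringFrom (2 : Fin 3))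
    (hF₁_order : 2 ≤ F₁.order) (hF₂_order : 2 ≤ F₂.order) (hF₃_order : 2 ≤ F₃.order)
    (a₂ b₂ c₂ : ℝ)
    (ha : MvPowerSeries.coeff (Finsupp.single 0 2) F₁ = a₂)
    (hb : MvPowerSeries.coeff (Finsupp.single 1 2) F₂ = b₂)
    (hc : MvPowerSeries.coeff (Finsupp.single 2 2) F₃ = c₂)
    (ha_ne : a₂ ≠ 0) (hb_ne : b₂ ≠ 0) (hc_ne : c₂ ≠ 0) :
    (∃ X ∈ FeedForward.fieldsOne 3, ∃ r ∈ FeedForward.orbitalOne 3,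
      ∃ φ ∈ FeedForward.maps 3, ∃ ψ ∈ FeedForward.maps 3,
        FeedForward.AreInverse φ ψ ∧
        (∀ V ∈ FeedForward.fields 3, FeedForward.TurnsInto φ V (FeedForward.expRho 0 X V)) ∧
        Set.BijOn (fun V => FeedForward.expRho r 0 (FeedForward.expRho 0 X V))
          (FeedForward.fields 3) (FeedForward.fields 3) ∧
        FeedForward.expRho r 0 (FeedForward.expRho 0 X (FeedForward.system F₁ F₂ F₃)) =
          FeedForward.normalForm a₂ b₂ c₂) ∧
    (∀ a b c : ℝ,
      Relation.ReflTransGen FeedForward.OuterStep (FeedForward.system F₁ F₂ F₃)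
        (FeedForward.normalForm a b c) → a = a₂ ∧ b = b₂ ∧ c = c₂) := by
  subst ha hb hc
  have hV := FeedForward.system_mem_fieldsSubmodule (F₁ := F₁) hF₂ hF₃
  have hlin := FeedForward.system_sub_system_mem_vecOrderGE hF₁_order hF₂_order hF₃_order
  refine ⟨?_, fun a b c h => ?_⟩
  · obtain ⟨φ, hφ, u, hu, hu₁, hφu⟩ := FeedForward.exists_maps_along_eq_mul hV hlin
      (FeedForward.coeff_single_system 0) (FeedForward.coeff_single_system 1)
      (FeedForward.coeff_single_system 2) ha_ne hb_ne hc_ne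
    obtain ⟨X, hX, r, hr, ψ, hψ, hφψ, hturns, hW⟩ :=
      FeedForward.exists_expRho_expRho_eq hφ hu hu₁ hφu
    have h₀ : (0 : Fin 3 → FeedForward.Series 3) ∈ FeedForward.orbitalOne 3 :=
      FeedForward.mem_orbitalOne.2 ⟨zero_mem _, zero_mem _⟩
    have h₀' : (0 : Fin 3 → FeedForward.Series 3) ∈ FeedForward.fieldsOne 3 :=
      FeedForward.mem_fieldsOne.2 ⟨zero_mem _, zero_mem _⟩
    exact ⟨X, hX, r, hr, φ, hφ, ψ, hψ, hφψ, fun V _ => hturns V,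
      (FeedForward.bijOn_expRho hr h₀').comp (FeedForward.bijOn_expRho h₀ hX), hW⟩
  · have hcoeff := FeedForward.coeff_single_eq_of_reflTransGen
      (FeedForward.mem_axisFields_two hV hlin) h
    simp only [FeedForward.normalForm, FeedForward.coeff_single_system] at hcoeff
    have hsq := FeedForward.coeff_single_C_mul_X_pow (n := 3)
    exact ⟨(hsq 0 a 2).symm.trans (hcoeff 0), (hsq 1 b 2).symm.trans (hcoeff 1),
      (hsq 2 c 2).symm.trans (hcoeff 2)⟩
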